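/- **Model.** Consider $N$ mobile stations $1,\dots,N$ and a base station $0$, a finite set $\mathcal S$ of network topologies and a finite set $\{\ell_1,\dots,\ell_M\}$ of power vectors $\ell_k=(\ell_{ijk})_{1\le i\le N,\,0\le j\le N,\,j\ne i}$. In topology $s$ and under $\ell_k$, link $(i,j)$ can carry $\mu_{ij}(s,\ell_k)\in\{0,1,\dots,\mu_{\max}\}$ packets per slot, and for each $i$ at most one of the rates $\mu_{ij}(s,\ell_k)$, $0\le j\le N$, $j\neq i$, is nonzero. All $\ell_{ijk}\ge 0$ and the average power bounds $\overline P_i\ge0$ are integer multiples of a common power unit, and $\sum_{j=0,\,j\ne i}^N\ell_{ijk}\le P_{\max}$. Station $i$ has an own queue $X_i$, a relay queue $Y_i$ and a virtual power queue $U_i$. If in slot $n$ the topology is $s(n)$ and power vector $\ell(n)$ is used, then $\min(X_i(n),\mu_{ij}(s(n),\ell(n)))$ packets move from $X_i$ to $Y_j$ for each $j\ne i$, $j\geq 1$; the link $(i,0)$ serves either $X_i$ or $Y_i$, removing $\min(\cdot,\mu_{i0}(s(n),\ell(n)))$ packets; then $A_i(n)$ new packets join $X_i$, and $U_i(n+1)=\max(U_i(n)-\overline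 P_i,0)+\sum_{j=0,\,j\neq i}^N\ell_{ij}(n)$. The arrival vectors $(A_i(n))_i$ are bounded, i.i.d. over slots, independent of the topologies, and have mean $\lambda=(\lambda_i)_i$. The topology evolves as an ergodic (irreducible, aperiodic) Markov chain on $\mathcal S$ with stationary distribution $\pi$. For $\epsilon\in\mathbb R$ let $\Lambda_\epsilon$ be the set of $\lambda$ for which there are $w_{sk}\ge 0$ with $\sum_k w_{sk}=1$ for all $s$, and $q_{isk}\in[0,1]$, such that for every $i$ $$\sum_{s,k}\pi_sw_{sk}\Big[\mu_{i0}(s,\ell_k)q_{isk}+\sum_{1\le j\le N,\,j\ne i}\mu_{ij}(s,\ell_k)\Big]\ge\lambda_i+\epsilon,$$ $$\sum_{s,k}\pi_s(1-q_{isk})w_{sk}\mu_{i0}(s,\ell_k)\ge\sum_{s,k}\sum_{1\le j\le N,\,j\ne i}\pi_sw_{sk}\mu_{ji}(s,\ell_k)+\epsilon,$$ $$\sum_{s,k}\pi_sw_{sk}\sum_{j=0,\,j\ne i}^N\ell_{ijk}+\epsilon\le\overline P_i .$$ The policy $\Delta^T_{RW}$ divides time into frames of $T$ slots. In every slot $n$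 of the frame that begins at time $KT$ it uses a power vector $\ell$ that maximizes (ties broken by any fixed rule) $$\sum_{i=1}^N\Big[\sum_{1\le j\le N,\,j\ne i}(X_i-Y_j)\mu_{ij}(s(n),\ell)+\max(X_i,Y_i)\mu_{i0}(s(n),\ell)-U_i\sum_{j=0,\,j\ne i}^N\ell_{ij}\Big],$$ where $X_i,Y_j,U_i$ are the queue lengths at time $KT$, and link $(i,0)$ serves the longer of $X_i(KT)$ and $Y_i(KT)$. Given any coupling of $T$ i.i.d. topologies of law $\pi$ with $T$ consecutive topologies of the Markov chain (the first of them having any law), let $\tau$ be the mismatch per slot, $$\tau=\frac1{2T}\sum_{s\in\mathcal S}\big|\#\{\text{visits to }s\text{ by the i.i.d. process}\}-\#\{\text{visits to }s\text{ by the Markov chain}\}\big|.$$ Call the system stable under $\Delta_{RW}^T$ if the Markov chain formed by $\mathbf X,\mathbf Y,\mathbf U$ and the topology, sampled at the times $KT$, $K\ge0$, is positive recurrent, has a stationary distribution, and under each stationary distribution the expected length of each of the queues is finite. (The chain need not be irreducible. Positive recurrence means that every closed communicating class is positive recurrent and that from every state the set of positive recurrent states is reached in finite expected time; for an irreducible chain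 this is the usual notion.) **Theorem.** (1) If $T\ge1$ and $\epsilon>\frac12\max\{(N+1)\mu_{\max}\mathbb E[\tau],\,P_{\max}\mathbb E[\tau]\}$ for some such coupling, then for every $\lambda\in\Lambda_\epsilon$ the system is stable under $\Delta^T_{RW}$. (2) $\mathbb E[\tau]\to0$ as $T\to\infty$, uniformly over all such couplings. (3) Consequently, for every $\epsilon>0$ there is $T_0$ such that for all $T\ge T_0$ and all $\lambda\in\Lambda_\epsilon$ the system is stable under $\Delta^T_{RW}$. -/

import Mathlib

open scoped ENNReal

noncomputable section

/-! Markov chains given by a transition kernel `P : α → PMF α`. -/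

namespace MarkovChain

variable {α : Type*}

/-- Expectation of a nonnegative function. -/
def expect (p : PMF α) (f : α → ℝ≥0∞) : ℝ≥0∞ := ∑' a, p a * f a

/-- The law of the chain after `n` steps, started at `x`. -/
def nstep (P : α → PMF α) : ℕ → α → PMF α
  | 0, x => PMF.pure x
  | n + 1, x => (P x).bind (nstep P n)

/-- `y` can be reached from `x`. -/
def Reaches (P : α → PMF α) (x y : α) : Prop := ∃ n, nstep P n x y ≠ 0

def IsIrreducible (P : α → PMF α) : Prop := ∀ x y, Reaches P x y

/-- Every state has period one. -/
def IsAperiodic (P : α → PMF α) : Prop :=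
  ∀ x, ∀ d : ℕ, (∀ n, 1 ≤ n → nstep P n x x ≠ 0 → d ∣ n) → d = 1

/-- Ergodicity; used for chains on a finite state space only, where irreducibility and
aperiodicity are all that has to be asked. -/
def IsErgodic (P : α → PMF α) : Prop := IsIrreducible P ∧ IsAperiodic P

def IsStationary (P : α → PMF α) (ν : PMF α) : Prop := ν.bind P = ν

open Classical in
/-- The probability that the chain started at `x` is outside `B` at all the times `1, …, n`. -/
def avoidProb (P : α → PMF α) (B : Set α) : ℕ → α → ℝ≥0∞
  | 0, _ => 1
  | n + 1, x => expect (P x) fun y => if y ∈ B then 0 else avoidProb P B n y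

/-- The expectation, for the chain started at `x`, of the first time `n ≥ 1` at which it is in `B`
(`∞` if it may never be there): the sum over `n` of the probabilities that this time exceeds `n`. -/
def meanReturnTime (P : α → PMF α) (B : Set α) (x : α) : ℝ≥0∞ := ∑' n, avoidProb P B n x

/-- `x` is a positive recurrent state. -/
def IsPosRecState (P : α → PMF α) (x : α) : Prop := meanReturnTime P {x} x < ∞

/-- `x` lies in a closed communicating class. -/
def IsEssential (P : α → PMF α) (x : α) : Prop := ∀ y, Reaches P x y → Reaches P y x

/-- Positive recurrence of a chain that need not be irreducible: every closed communicating class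
is positive recurrent, and from every state the chain reaches the positive recurrent states in
finite expected time. For an irreducible chain this says that every state is positive recurrent. -/
structure IsPosRecurrent (P : α → PMF α) : Prop where
  essential : ∀ x, IsEssential P x → IsPosRecState P x
  reached : ∀ x, meanReturnTime P {y | IsPosRecState P y} x < ∞

end MarkovChain

/-! The network: mobile stations `Fin N`, destinations `Option (Fin N)` (`none` is the base
station), topologies `S`, power vectors `K`. -/

/-- The state of all the queues: own queues `X`, relay queues `Y` (in packets) and virtual power
queues `U` (in power units). -/
structure Queues (N : ℕ) where
  X : Fin N → ℕ
  Y : Fin N → ℕ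
  U : Fin N → ℕ

/-- The fixed data of the network. All powers are multiples of the unit `powerUnit`. -/
structure RelayNetwork (N : ℕ) (S K : Type*) where
  /-- packets per slot that link `(i, d)` carries in topology `s` under power vector `k` -/
  rate : S → K → Fin N → Option (Fin N) → ℕ
  powerUnit : ℝ
  powerUnit_pos : 0 < powerUnit
  /-- power that station `i` spends on link `(i, d)` under power vector `k`, in units -/
  powerCount : K → Fin N → Option (Fin N) → ℕ
  /-- bound on the average power of each station, in units -/
  budgetCount : Fin N → ℕ
  rateMax : ℕ
  powerMax : ℝ
  rate_le : ∀ s k i d, rate s k i d ≤ rateMax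
  power_le : ∀ k i,
    powerUnit * ((∑ d with d ≠ some i, powerCount k i d : ℕ) : ℝ) ≤ powerMax
  /-- a station transmits to at most one receiver in a slot -/
  one_receiver : ∀ s k i d d', d ≠ some i → d' ≠ some i →
    rate s k i d ≠ 0 → rate s k i d' ≠ 0 → d = d'

namespace RelayNetwork

variable {N : ℕ} {S K : Type*} (net : RelayNetwork N S K)

/-- Number of power units that station `i` spends in a slot under `k`. -/
def usedCount (k : K) (i : Fin N) : ℕ := ∑ d with d ≠ some i, net.powerCount k i d

/-- Power that station `i` spends in a slot under `k`. -/
def usedPower (k : K) (i : Fin N) : ℝ := net.powerUnit * (net.usedCount k i : ℝ)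

/-- Bound on the average power of station `i`. -/
def budget (i : Fin N) : ℝ := net.powerUnit * (net.budgetCount i : ℝ)

/-- The rate vectors that a randomized choice of the power vectors and of the served queues
supports with slack `ε`, when the topology has law `π`: `w s k` is the probability of power vector
`k` in topology `s`, and `q i s k` that of serving the own queue on the link to the base station. -/
def region [Fintype S] [Fintype K] (π : PMF S) (ε : ℝ) : Set (Fin N → ℝ) :=
  {lam | ∃ (w : S → K → ℝ) (q : Fin N → S → K → ℝ),
    (∀ s k, 0 ≤ w s k) ∧ (∀ s, ∑ k, w s k = 1) ∧
    (∀ i s k, 0 ≤ q i s k ∧ q i s k ≤ 1) ∧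
    (∀ i, lam i + ε ≤ ∑ s, ∑ k, (π s).toReal * w s k *
      (net.rate s k i none * q i s k + ∑ j with j ≠ i, (net.rate s k i (some j) : ℝ))) ∧
    (∀ i, (∑ s, ∑ k, ∑ j with j ≠ i, (π s).toReal * w s k * (net.rate s k j (some i) : ℝ)) + ε ≤
      ∑ s, ∑ k, (π s).toReal * (1 - q i s k) * w s k * net.rate s k i none) ∧
    (∀ i, (∑ s, ∑ k, (π s).toReal * w s k * net.usedPower k i) + ε ≤ net.budget i)}

/-- The weight that the policy maximizes. -/
def weight (q : Queues N) (s : S) (k : K) : ℝ :=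
  ∑ i, ((∑ j with j ≠ i, ((q.X i : ℝ) - q.Y j) * net.rate s k i (some j)) +
    max (q.X i : ℝ) (q.Y i) * net.rate s k i none -
    (net.powerUnit * q.U i) * net.usedPower k i)

/-- A max-weight decision rule with an arbitrary breaking of ties: `choose` is the power vector, and
`own` tells whether a station serves its own queue (the relay queue otherwise) on its link to the
base station. -/
structure MaxWeightRule where
  choose : Queues N → S → K
  own : Queues N → S → Fin N → Bool
  choose_max : ∀ q s k, net.weight q s k ≤ net.weight q s (choose q s)
  own_true : ∀ q s i, own q s i = true → q.Y i ≤ q.X i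
  own_false : ∀ q s i, own q s i = false → q.X i ≤ q.Y i

/-- Packets that move from own queue `i` to relay queue `j`. -/
def toRelay (q : Queues N) (s : S) (k : K) (i j : Fin N) : ℕ :=
  if j = i then 0 else min (q.X i) (net.rate s k i (some j))

/-- Packets from own queue `i` to the base station; `own` tells which queues are served there. -/
def ownToBase (q : Queues N) (s : S) (k : K) (own : Fin N → Bool) (i : Fin N) : ℕ :=
  if own i then min (q.X i) (net.rate s k i none) else 0

/-- Packets from relay queue `i` to the base station. -/
def relayToBase (q : Queues N) (s : S) (k : K) (own : Fin N → Bool) (i : Fin N) : ℕ :=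
  if own i then 0 else min (q.Y i) (net.rate s k i none)

/-- The queues at the end of a slot with arrivals `a`. -/
def slot (q : Queues N) (s : S) (k : K) (own : Fin N → Bool) (a : Fin N → ℕ) : Queues N where
  X i := q.X i - (net.ownToBase q s k own i + ∑ j, net.toRelay q s k i j) + a i
  Y i := q.Y i - net.relayToBase q s k own i + ∑ j, net.toRelay q s k j i
  U i := q.U i - net.budgetCount i + net.usedCount k i

variable {net}

/-- The law of queues and topology after `n` slots, started at `x`, when every decision uses the
current topology and the queues `q₀` of the beginning of the frame. Arrivals are independent from
slot to slot with law `arr`, and independent of the topology, which moves by `P`. -/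
def runFrame (rule : net.MaxWeightRule) (P : S → PMF S) (arr : PMF (Fin N → ℕ)) (q₀ : Queues N) :
    ℕ → Queues N × S → PMF (Queues N × S)
  | 0, x => PMF.pure x
  | n + 1, x => arr.bind fun a => (P x.2).bind fun s' =>
      runFrame rule P arr q₀ n
        (net.slot x.1 x.2 (rule.choose q₀ x.2) (rule.own q₀ x.2) a, s')

/-- The transition kernel of queues and topology sampled at the times `0, T, 2T, …`, under the
policy with frames of `T` slots. -/
def frameChain (rule : net.MaxWeightRule) (P : S → PMF S) (arr : PMF (Fin N → ℕ)) (T : ℕ)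
    (x : Queues N × S) : PMF (Queues N × S) :=
  runFrame rule P arr x.1 T x

/-- Stability of the sampled chain: it is positive recurrent, it has a stationary law, and under
every stationary law all the queues have finite mean. -/
structure IsStable (C : Queues N × S → PMF (Queues N × S)) : Prop where
  posRecurrent : MarkovChain.IsPosRecurrent C
  exists_stationary : ∃ ν, MarkovChain.IsStationary C ν
  finite_mean : ∀ ν, MarkovChain.IsStationary C ν → ∀ i,
    MarkovChain.expect ν (fun x => (x.1.X i : ℝ≥0∞)) < ∞ ∧
    MarkovChain.expect ν (fun x => (x.1.Y i : ℝ≥0∞)) < ∞ ∧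
    MarkovChain.expect ν (fun x => (x.1.U i : ℝ≥0∞)) < ∞

end RelayNetwork

/-- Mean number of arrivals per slot at station `i`. -/
def meanArrival {N : ℕ} (arr : PMF (Fin N → ℕ)) (i : Fin N) : ℝ :=
  ∑' a, (arr a).toReal * (a i : ℝ)

/-! The mismatch between the topologies of a frame and independent ones. -/

namespace Topology

variable {S : Type*}

/-- The law of the topologies of `n` slots, the first of which has topology `s`. -/
def walkPath (P : S → PMF S) : ℕ → S → PMF (List S)
  | 0, _ => PMF.pure []
  | n + 1, s => (P s).bind fun s' => (walkPath P n s').map (List.cons s)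

/-- The law of `n` independent topologies of law `π`. -/
def iidPath (π : PMF S) : ℕ → PMF (List S)
  | 0 => PMF.pure []
  | n + 1 => π.bind fun s => (iidPath π n).map (List.cons s)

/-- `γ` is a joint law of `T` independent topologies of law `π` and of `T` slots of the walk `P`
whose first topology has law `ρ`. -/
structure IsFrameCoupling (P : S → PMF S) (π : PMF S) (T : ℕ) (ρ : PMF S)
    (γ : PMF (List S × List S)) : Prop where
  iid : γ.map Prod.fst = iidPath π T
  walk : γ.map Prod.snd = ρ.bind (walkPath P T)

/-- The number of slots in which two lists of topologies of the same length differ after the best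
rearrangement, i.e. half the sum of the absolute differences between the numbers of visits; for two
topologies, the difference between the numbers of visits to either of them. -/
def mismatch [Fintype S] [DecidableEq S] (l l' : List S) : ℕ := ∑ s, (l.count s - l'.count s)

/-- The expected mismatch per slot of a frame of `T` slots. -/
def meanMismatch [Fintype S] [DecidableEq S] (T : ℕ) (γ : PMF (List S × List S)) : ℝ :=
  (MarkovChain.expect γ fun p => (mismatch p.1 p.2 : ℝ≥0∞)).toReal / T

end Topology

end

/-! Stability comes from a quadratic Lyapunov function corrected by a solution of a Poisson
equation. With the decisions of a frame based on its initial queues `q₀`, one slot changes the sum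
of squares (`energy`) by at most a constant plus twice (load minus maximal weight in the current
topology), by `energy_slot_le`. For rates in the region, the maximal weight averaged over `π`
exceeds the load by `ε` times the queues (`load_le_value`), because the maximum beats the randomized
policy. The difference between the weight in the current topology and its stationary mean is
absorbed by the corrector `h q₀` of `exists_corrector`: subtracting `2 * h q₀ s` from the energy
replaces the one by the other exactly (`expect_slot_le`).

The corrector is Lipschitz in the queues, and queues move by a bounded amount within a frame, so
exchanging `h q₀` for the corrector of the final queues costs a constant. Summing over the slots
gives a drift for the sampled chain, negative and linear in the queues up to a constant
(`exists_lyapunov`). This works for every `T ≥ 1` and every `ε > 0`; the mismatch threshold is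
nonnegative, so a slack above it is positive.

`foster` turns the drift into stability without irreducibility: a finite set is reached in finite
mean time, every state leads to one of finitely many candidates for an essential state, essential
states are positive recurrent, and a stationary law is an occupation measure of excursions.

The mismatch vanishes because visit counts have variance of order `T`. Poisson solutions for
indicator functions turn centred counts into martingales up to bounded terms
(`expect_walkPath_sq_le`), uniformly in the initial law; only the marginals of a coupling enter the
estimate. -/

noncomputable section

namespace MarkovChain

variable {α β : Type*}

/-! ### Expectations with values in `[0, ∞]`. -/

section Expectation

theorem expect_const (p : PMF α) (c : ℝ≥0∞) : expect p (fun _ => c) = c := by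
  simp [expect, ENNReal.tsum_mul_right, p.tsum_coe]

theorem expect_add (p : PMF α) (f g : α → ℝ≥0∞) :
    expect p (fun a => f a + g a) = expect p f + expect p g := by
  simp [expect, mul_add, ENNReal.tsum_add]

theorem expect_mul_const (p : PMF α) (f : α → ℝ≥0∞) (c : ℝ≥0∞) :
    expect p (fun a => f a * c) = expect p f * c := by
  simp [expect, ← mul_assoc, ENNReal.tsum_mul_right]

theorem expect_mono_support {p : PMF α} {f g : α → ℝ≥0∞} (h : ∀ a ∈ p.support, f a ≤ g a) :
    expect p f ≤ expect p g := by
  refine ENNReal.tsum_le_tsum fun a => ?_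
  by_cases ha : p a = 0
  · simp [ha]
  · exact mul_le_mul_right (h a ((PMF.mem_support_iff _ _).2 ha)) _

theorem expect_mono {p : PMF α} {f g : α → ℝ≥0∞} (h : ∀ a, f a ≤ g a) :
    expect p f ≤ expect p g :=
  expect_mono_support fun a _ => h a

theorem expect_pure (a : α) (f : α → ℝ≥0∞) : expect (PMF.pure a) f = f a := by
  rw [expect, tsum_eq_single a]
  · simp
  · intro b hb
    simp [PMF.pure_apply, hb]

theorem expect_bind (p : PMF α) (k : α → PMF β) (f : β → ℝ≥0∞) :
    expect (p.bind k) f = expect p fun a => expect (k a) f := by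
  simp only [expect, PMF.bind_apply, ← ENNReal.tsum_mul_right, ← ENNReal.tsum_mul_left]
  rw [ENNReal.tsum_comm]
  simp only [mul_assoc]

theorem expect_map (p : PMF α) (g : α → β) (f : β → ℝ≥0∞) :
    expect (p.map g) f = expect p fun a => f (g a) := by
  rw [PMF.map, expect_bind]
  simp [expect_pure]

theorem expect_tsum {ι : Type*} (p : PMF α) (f : ι → α → ℝ≥0∞) :
    expect p (fun a => ∑' n, f n a) = ∑' n, expect p (f n) := by
  simp only [expect, ← ENNReal.tsum_mul_left]
  rw [ENNReal.tsum_comm]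

theorem expect_finset_sum {ι : Type*} (p : PMF α) (t : Finset ι) (f : ι → α → ℝ≥0∞) :
    expect p (fun a => ∑ n ∈ t, f n a) = ∑ n ∈ t, expect p (f n) := by
  classical
  induction t using Finset.induction_on with
  | empty => simp [expect_const]
  | insert i t hi ih => simp [Finset.sum_insert hi, expect_add, ih]

open Classical in
theorem expect_single (p : PMF α) (z : α) (c : ℝ≥0∞) :
    expect p (fun y => if y = z then c else 0) = p z * c := by
  rw [expect, tsum_eq_single z]
  · simp
  · intro b hb
    simp [hb]

end Expectation

/-! ### Potential theory of the killed chain. -/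

section Potential

variable (P : α → PMF α) (B : Set α)

open Classical in
/-- One step of the chain killed on entering `B`. -/
def killed (u : α → ℝ≥0∞) (x : α) : ℝ≥0∞ := expect (P x) fun y => if y ∈ B then 0 else u y

/-- The expected sum of `g` over the times before the chain enters `B`. -/
def potential (g : α → ℝ≥0∞) (x : α) : ℝ≥0∞ := ∑' n, (killed P B)^[n] g x

variable {P B}

theorem killed_add (u v : α → ℝ≥0∞) (x : α) :
    killed P B (fun y => u y + v y) x = killed P B u x + killed P B v x := by
  rw [killed, killed, killed, ← expect_add]
  congr 1
  ext y
  split_ifs <;> simp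

theorem killed_mul_const (u : α → ℝ≥0∞) (c : ℝ≥0∞) (x : α) :
    killed P B (fun y => u y * c) x = killed P B u x * c := by
  rw [killed, killed, ← expect_mul_const]
  congr 1
  ext y
  split_ifs <;> simp

theorem killed_tsum (u : ℕ → α → ℝ≥0∞) (x : α) :
    killed P B (fun y => ∑' n, u n y) x = ∑' n, killed P B (u n) x := by
  simp only [killed]
  rw [← expect_tsum]
  congr 1
  ext y
  split_ifs <;> simp

theorem killed_finset_sum {ι : Type*} (t : Finset ι) (u : ι → α → ℝ≥0∞) (x : α) :
    killed P B (fun y => ∑ n ∈ t, u n y) x = ∑ n ∈ t, killed P B (u n) x := by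
  simp only [killed]
  rw [← expect_finset_sum]
  congr 1
  ext y
  split_ifs <;> simp

theorem killed_mono {u v : α → ℝ≥0∞} (h : ∀ y, y ∉ B → u y ≤ v y) (x : α) :
    killed P B u x ≤ killed P B v x :=
  expect_mono fun y => by
    split_ifs with hy
    · exact le_rfl
    · exact h y hy

theorem avoidProb_eq_iterate (n : ℕ) :
    avoidProb P B n = (killed P B)^[n] (fun _ => 1) := by
  induction n with
  | zero => rfl
  | succ n ih =>
    rw [Function.iterate_succ_apply', ← ih]
    rfl

theorem meanReturnTime_eq_potential (x : α) :
    meanReturnTime P B x = potential P B (fun _ => 1) x := by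
  simp only [meanReturnTime, potential, avoidProb_eq_iterate]

theorem potential_eq (g : α → ℝ≥0∞) (x : α) :
    potential P B g x = g x + killed P B (potential P B g) x := by
  have h : killed P B (potential P B g) x = ∑' n, killed P B ((killed P B)^[n] g) x :=
    killed_tsum _ x
  rw [h, potential, tsum_eq_zero_add' ENNReal.summable]
  simp only [Function.iterate_succ_apply', Function.iterate_zero, id]

/-- Minimality: the partial sums stay below any supersolution, by induction on their length. All
bounds on mean return times come from here. -/
theorem potential_le {g v : α → ℝ≥0∞} (h : ∀ x, g x + killed P B v x ≤ v x) (x : α) :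
    potential P B g x ≤ v x := by
  refine ENNReal.tsum_le_of_sum_range_le fun n => ?_
  induction n generalizing x with
  | zero => simp
  | succ n ih =>
    rw [Finset.sum_range_succ', add_comm]
    simp only [Function.iterate_succ_apply', Function.iterate_zero, id]
    rw [← killed_finset_sum]
    exact (add_le_add_right (killed_mono (fun y _ => ih y) x) _).trans (h x)

theorem iterate_killed_add (g g' : α → ℝ≥0∞) (n : ℕ) :
    (killed P B)^[n] (fun y => g y + g' y) =
      fun y => (killed P B)^[n] g y + (killed P B)^[n] g' y := by
  induction n with
  | zero => rfl
  | succ n ih =>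
    simp only [Function.iterate_succ_apply', ih]
    ext x
    exact killed_add _ _ x

theorem potential_add (g g' : α → ℝ≥0∞) (x : α) :
    potential P B (fun y => g y + g' y) x = potential P B g x + potential P B g' x := by
  simp only [potential, iterate_killed_add, ENNReal.tsum_add]

theorem meanReturnTime_eq (x : α) :
    meanReturnTime P B x = 1 + killed P B (meanReturnTime P B) x := by
  have h : meanReturnTime P B = potential P B (fun _ => 1) := funext meanReturnTime_eq_potential
  rw [h]
  exact potential_eq _ x

theorem meanReturnTime_le {v : α → ℝ≥0∞} (h : ∀ x, 1 + killed P B v x ≤ v x) (x : α) :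
    meanReturnTime P B x ≤ v x := by
  rw [meanReturnTime_eq_potential]
  exact potential_le h x

theorem meanReturnTime_anti {A : Set α} (h : A ⊆ B) (x : α) :
    meanReturnTime P B x ≤ meanReturnTime P A x := by
  refine meanReturnTime_le (fun x => ?_) x
  conv_rhs => rw [meanReturnTime_eq]
  refine add_le_add_right (expect_mono fun y => ?_) _
  by_cases hA : y ∈ A
  · simp [hA, h hA]
  · by_cases hB : y ∈ B <;> simp [hA, hB]

/-- Outside `B` the value function decreases by one in the mean: `B` is reached. -/
theorem meanReturnTime_le_of_drift {V : α → ℝ≥0∞}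
    (h : ∀ x, x ∉ B → expect (P x) V + 1 ≤ V x) (x : α) :
    meanReturnTime P B x ≤ 1 + expect (P x) V := by
  classical
  -- The drift is known only outside `B`, so on `B` the supersolution is the value after one forced
  -- step.
  have key : ∀ x, meanReturnTime P B x ≤ if x ∈ B then 1 + expect (P x) V else V x := by
    refine meanReturnTime_le fun x => ?_
    have h1 : killed P B (fun x => if x ∈ B then 1 + expect (P x) V else V x) x ≤
        expect (P x) V :=
      expect_mono fun y => by by_cases hy : y ∈ B <;> simp [hy]
    split_ifs with hx
    · gcongr
    · refine le_trans ?_ (h x hx)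
      rw [add_comm]
      gcongr
  rw [meanReturnTime_eq]
  refine add_le_add_right (expect_mono fun y => ?_) _
  have := key y
  split_ifs at this ⊢ with hy
  · simp
  · exact this

end Potential

/-! ### Communication between states and finite hitting times. -/

section Reaches

variable {P : α → PMF α}

theorem reaches_iff {x y : α} :
    Reaches P x y ↔ Relation.ReflTransGen (fun a b => P a b ≠ 0) x y := by
  constructor
  · rintro ⟨n, hn⟩
    induction n generalizing x with
    | zero =>
      have : y = x := by
        by_contra h
        exact hn (by simp [nstep, PMF.pure_apply, h])
      exact this ▸ Relation.ReflTransGen.refl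
    | succ n ih =>
      rw [nstep, ← PMF.mem_support_iff, PMF.mem_support_bind_iff] at hn
      obtain ⟨w, hw, hwy⟩ := hn
      exact Relation.ReflTransGen.head ((PMF.mem_support_iff _ _).1 hw)
        (ih ((PMF.mem_support_iff _ _).1 hwy))
  · intro h
    induction h using Relation.ReflTransGen.head_induction_on with
    | refl => exact ⟨0, by simp [nstep]⟩
    | head hab _ ih =>
      obtain ⟨n, hn⟩ := ih
      refine ⟨n + 1, ?_⟩
      rw [nstep, ← PMF.mem_support_iff, PMF.mem_support_bind_iff]
      exact ⟨_, (PMF.mem_support_iff _ _).2 hab, (PMF.mem_support_iff _ _).2 hn⟩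

theorem Reaches.refl (x : α) : Reaches P x x := reaches_iff.2 .refl

theorem Reaches.trans {x y z : α} (h : Reaches P x y) (h' : Reaches P y z) : Reaches P x z :=
  reaches_iff.2 ((reaches_iff.1 h).trans (reaches_iff.1 h'))

theorem Reaches.of_step {x y : α} (h : P x y ≠ 0) : Reaches P x y :=
  reaches_iff.2 (.single h)

/-- A set that is closed under steps contains all that can be reached from it. -/
theorem Reaches.mem_of_closed {C : Set α} (hC : ∀ x ∈ C, ∀ y, P x y ≠ 0 → y ∈ C) {x y : α}
    (h : Reaches P x y) (hx : x ∈ C) : y ∈ C := by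
  rw [reaches_iff] at h
  induction h with
  | refl => exact hx
  | tail _ hab ih => exact hC _ ih _ hab

theorem killed_eq_zero {B : Set α} {u : α → ℝ≥0∞} {x : α} (h : killed P B u x = 0) {y : α}
    (hy : P x y ≠ 0) (hB : y ∉ B) : u y = 0 := by
  rw [killed, expect, ENNReal.tsum_eq_zero] at h
  simpa [hy, hB] using h y

/-- A state from which `B` can be reached need not be in the target set. -/
theorem meanReturnTime_lt_top_of_insert {B : Set α} {z : α}
    (hz : ∃ y ∈ B, Reaches P z y) (h : ∀ x, meanReturnTime P (insert z B) x < ∞) (x : α) :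
    meanReturnTime P B x < ∞ := by
  classical
  by_cases hzB : z ∈ B
  · simpa [Set.insert_eq_of_mem hzB] using h x
  set A := insert z B with hA
  set u := meanReturnTime P A with hu
  -- `r x` and `r' x` are the probabilities that the first entry into `A` after time 0 happens at
  -- `z`, respectively in `B`.
  set r := potential P A (fun x => P x z) with hr
  set r' := potential P A (fun x => expect (P x) fun y => if y ∈ B then 1 else 0) with hr'
  have hr_eq : ∀ x, r x = P x z + killed P A r x := fun x => potential_eq _ x
  have hr'_eq : ∀ x, r' x = (expect (P x) fun y => if y ∈ B then 1 else 0) + killed P A r' x :=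
    fun x => potential_eq _ x
  have hsum : ∀ x, r x + r' x ≤ 1 := by
    intro x
    rw [hr, hr', ← potential_add]
    refine potential_le (v := fun _ => 1) (fun x => ?_) x
    rw [← mul_one (P x z), ← expect_single (P x) z 1, killed, ← expect_add, ← expect_add]
    refine (expect_mono fun y => ?_).trans (expect_const (P x) 1).le
    by_cases h1 : y = z
    · subst h1
      simp [hzB, hA]
    · by_cases h2 : y ∈ B <;> simp [h1, h2, hA]
  -- Otherwise the states outside `B` with `r' = 0` form a closed set containing `z`, and `B` is out
  -- of reach.
  have hr'z : r' z ≠ 0 := by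
    intro h0
    obtain ⟨y, hyB, hy⟩ := hz
    have hcl : ∀ x ∈ {x | r' x = 0 ∧ x ∉ B}, ∀ y, P x y ≠ 0 → y ∈ {x | r' x = 0 ∧ x ∉ B} := by
      rintro x ⟨hx, -⟩ y hy
      rw [hr'_eq, add_eq_zero] at hx
      have hyB : y ∉ B := by
        intro hyB
        have := hx.1
        rw [expect, ENNReal.tsum_eq_zero] at this
        simpa [hyB, hy] using this y
      refine ⟨?_, hyB⟩
      by_cases hyz : y = z
      · exact hyz ▸ h0
      · exact killed_eq_zero hx.2 hy (by simp [hA, hyz, hyB])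
    exact (hy.mem_of_closed hcl ⟨h0, hzB⟩).2 hyB
  have hrz1 : r z < 1 := by
    have hle := hsum z
    have hne : r z ≠ ∞ := ne_top_of_le_ne_top ENNReal.one_ne_top (le_self_add.trans hle)
    exact (ENNReal.lt_add_right hne hr'z).trans_le hle
  -- Excursions from `z` last `u z` in the mean and end at `z` again with probability `r z < 1`. The
  -- geometric series gives the solution of `c = u z + r z * c`, so that `u + r * c` is a
  -- supersolution for `B`.
  set c := u z / (1 - r z) with hc
  have hsub : 1 - r z ≠ 0 := (tsub_pos_of_lt hrz1).ne'
  have hsub' : 1 - r z ≠ ∞ := ne_top_of_le_ne_top ENNReal.one_ne_top tsub_le_self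
  have hctop : c < ∞ := ENNReal.div_lt_top (h z).ne hsub
  have hcz : u z + r z * c = c := by
    have h1 : u z = (1 - r z) * c := by
      rw [hc, ENNReal.mul_div_cancel hsub hsub']
    rw [h1, ← add_mul, tsub_add_cancel_of_le hrz1.le, one_mul]
  have hv : ∀ x, meanReturnTime P B x ≤ u x + r x * c := by
    refine meanReturnTime_le fun x => ?_
    have hsplit : killed P B (fun x => u x + r x * c) x =
        P x z * c + killed P A (fun x => u x + r x * c) x := by
      rw [← expect_single, killed, killed, ← expect_add]
      congr 1
      ext y
      by_cases h1 : y = z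
      · subst h1
        simp [hzB, hA, hcz]
      · by_cases h2 : y ∈ B <;> simp [h1, h2, hA]
    have hu_eq : u x = 1 + killed P A u x := meanReturnTime_eq x
    rw [hsplit, killed_add, killed_mul_const, hr_eq x]
    conv_rhs => rw [hu_eq]
    apply le_of_eq
    ring
  have hr1 : r x ≤ 1 := le_self_add.trans (hsum x)
  exact (hv x).trans_lt (ENNReal.add_lt_top.2
    ⟨h x, ENNReal.mul_lt_top (hr1.trans_lt ENNReal.one_lt_top) hctop⟩)

/-- If a finite set is reached in finite mean time and `B` can be reached from each of its states,
then `B` is reached in finite mean time. -/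
theorem meanReturnTime_lt_top_of_finite {B F : Set α} (hF : F.Finite)
    (hFB : ∀ z ∈ F, ∃ y ∈ B, Reaches P z y) (h : ∀ x, meanReturnTime P F x < ∞) (x : α) :
    meanReturnTime P B x < ∞ := by
  have h' : ∀ x, meanReturnTime P (F ∪ B) x < ∞ := fun x =>
    (meanReturnTime_anti Set.subset_union_left x).trans_lt (h x)
  clear h
  induction F, hF using Set.Finite.induction_on generalizing x with
  | empty => simpa using h' x
  | @insert z F _ _ ih =>
    refine ih (fun w hw => hFB w (Set.mem_insert_of_mem _ hw)) x fun x => ?_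
    obtain ⟨y, hy, hzy⟩ := hFB z (Set.mem_insert _ _)
    refine meanReturnTime_lt_top_of_insert ⟨y, Or.inr hy, hzy⟩ (fun x => ?_) x
    rw [← Set.insert_union]
    exact h' x

/-- If `B` were out of reach, all avoidance probabilities would be 1 and their sum infinite. -/
theorem exists_reaches_of_meanReturnTime_lt_top {B : Set α} {x : α}
    (h : meanReturnTime P B x < ∞) : ∃ y ∈ B, Reaches P x y := by
  by_contra! hcon
  have key : ∀ n, ∀ w, Reaches P x w → avoidProb P B n w = 1 := by
    intro n
    induction n with
    | zero => intros; rfl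
    | succ n ih =>
      intro w hw
      rw [avoidProb]
      refine Eq.trans (le_antisymm (expect_mono_support fun y hy => ?_)
        (expect_mono_support fun y hy => ?_)) (expect_const (P w) 1)
      all_goals
        have hy' : Reaches P x y := hw.trans (.of_step ((PMF.mem_support_iff _ _).1 hy))
        have hyB : y ∉ B := fun hB => hcon y hB hy'
        simp [hyB, ih y hy']
  rw [meanReturnTime] at h
  simp only [key _ x (.refl x)] at h
  simp at h

/-- Adding to `{x}` all states out of reach of `x` makes the target accessible from every state of
`F`, yet does not change the return time of the chain started at `x`. -/
theorem IsEssential.isPosRecState {F : Set α} (hF : F.Finite)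
    (h : ∀ x, meanReturnTime P F x < ∞) {x : α} (hx : IsEssential P x) : IsPosRecState P x := by
  set B : Set α := {y | y = x ∨ ¬ Reaches P x y} with hB
  have hfin : meanReturnTime P B x < ∞ := by
    refine meanReturnTime_lt_top_of_finite hF (fun z _ => ?_) h x
    by_cases hz : Reaches P x z
    · exact ⟨x, Or.inl rfl, hx z hz⟩
    · exact ⟨z, Or.inr hz, .refl z⟩
  have key : ∀ n, ∀ w, Reaches P x w → avoidProb P {x} n w = avoidProb P B n w := by
    intro n
    induction n with
    | zero => intros; rfl
    | succ n ih =>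
      intro w hw
      rw [avoidProb, avoidProb]
      refine le_antisymm (expect_mono_support fun y hy => ?_) (expect_mono_support fun y hy => ?_)
      all_goals
        have hy' : Reaches P x y := hw.trans (.of_step ((PMF.mem_support_iff _ _).1 hy))
        have hBy : y ∈ B ↔ y = x := by simp [hB, hy']
        by_cases hyx : y = x
        · simp only [hBy.2 hyx, show y ∈ ({x} : Set α) from hyx, if_true, le_refl]
        · simp only [mt hBy.1 hyx, Set.mem_singleton_iff, hyx, if_false, ih y hy', le_refl]
  rw [IsPosRecState, meanReturnTime]
  simp only [key _ x (.refl x)]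
  exact hfin

/-- Reachability is a preorder. A maximal element of the part of `F` reachable from `x` is
essential: whatever it reaches leads back to that part, hence to it by maximality. -/
theorem exists_reaches_essential {F : Set α} (hF : F.Finite)
    (h : ∀ x, ∃ y ∈ F, Reaches P x y) (x : α) : ∃ y, IsEssential P y ∧ Reaches P x y := by
  obtain ⟨y₀, hy₀, hxy₀⟩ := h x
  let G : Set α := {y ∈ F | Reaches P x y}
  have hG : G.Finite := hF.subset fun y hy => hy.1
  let _ : Preorder α :=
    { le := Reaches P
      le_refl := Reaches.refl
      le_trans := fun _ _ _ => Reaches.trans }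
  obtain ⟨y, hy⟩ := hG.exists_maximal ⟨y₀, hy₀, hxy₀⟩
  refine ⟨y, fun z hyz => ?_, hy.prop.2⟩
  obtain ⟨w, hw, hzw⟩ := h z
  have hyw : Reaches P y w := hyz.trans hzw
  exact hzw.trans (hy.le_of_ge ⟨hw, hy.prop.2.trans hyw⟩ hyw)

end Reaches

/-! ### Stationary laws: existence and moments. -/

section Stationary

variable {P : α → PMF α}

open Classical in
/-- The occupation law at time `n` of the chain started at `x` and killed on its return. -/
def excursion (P : α → PMF α) (x : α) : ℕ → α → ℝ≥0∞
  | 0, y => if y = x then 1 else 0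
  | n + 1, y => if y = x then 0 else ∑' z, excursion P x n z * P z y

theorem tsum_excursion_mul (x : α) (n : ℕ) (u : α → ℝ≥0∞) :
    ∑' y, excursion P x n y * u y = (killed P {x})^[n] u x := by
  classical
  induction n generalizing u with
  | zero =>
    rw [tsum_eq_single x]
    · simp [excursion]
    · intro y hy
      simp [excursion, hy]
  | succ n ih =>
    rw [Function.iterate_succ_apply, ← ih]
    simp only [killed, expect, ← ENNReal.tsum_mul_left]
    rw [ENNReal.tsum_comm]
    refine tsum_congr fun y => ?_
    by_cases hy : y = x
    · simp [excursion, hy]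
    · simp [excursion, hy, ← ENNReal.tsum_mul_right, mul_assoc]

theorem tsum_mul_step (m : α → ℝ≥0∞) : ∑' y, ∑' z, m z * P z y = ∑' z, m z := by
  rw [ENNReal.tsum_comm]
  simp [ENNReal.tsum_mul_left, PMF.tsum_coe]

/-- The expected numbers of visits during an excursion from `x` form an invariant measure, whose
mass is the mean return time. -/
theorem IsPosRecState.exists_stationary {x : α} (hx : IsPosRecState P x) :
    ∃ ν, IsStationary P ν := by
  classical
  set m : α → ℝ≥0∞ := fun y => ∑' n, excursion P x n y with hm
  have hmass : ∑' y, m y = meanReturnTime P {x} x := by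
    rw [hm, ENNReal.tsum_comm, meanReturnTime]
    refine tsum_congr fun n => ?_
    rw [avoidProb_eq_iterate, ← tsum_excursion_mul]
    simp
  have hfin : ∑' y, m y ≠ ∞ := by
    rw [hmass]
    exact ne_of_lt hx
  have hmx : m x = 1 := by
    rw [hm]
    simp only
    rw [tsum_eq_single 0]
    · simp [excursion]
    · intro n hn
      obtain ⟨k, rfl⟩ := Nat.exists_eq_succ_of_ne_zero hn
      simp [excursion]
  have hne : ∑' y, m y ≠ 0 := by
    intro h0
    rw [ENNReal.tsum_eq_zero] at h0
    simpa [hmx] using h0 x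
  have hstep : ∀ y, y ≠ x → ∑' z, m z * P z y = m y := by
    intro y hy
    simp only [hm, ← ENNReal.tsum_mul_right]
    rw [ENNReal.tsum_comm]
    conv_rhs => rw [tsum_eq_zero_add' ENNReal.summable]
    simp [excursion, hy]
  have hinv : ∀ y, ∑' z, m z * P z y = m y := by
    intro y
    by_cases hy : y = x
    · subst hy
      -- A step preserves the finite total mass, so invariance at all other states forces it at `y`.
      have htot := tsum_mul_step (P := P) m
      rw [ENNReal.tsum_eq_add_tsum_ite y, ENNReal.tsum_eq_add_tsum_ite (f := m) y] at htot
      have hrest : (∑' w, if w = y then 0 else ∑' z, m z * P z w) =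
          ∑' w, if w = y then 0 else m w :=
        tsum_congr fun w => by
          split_ifs with hw
          · rfl
          · exact hstep w hw
      have hrestfin : (∑' w, if w = y then 0 else m w) ≠ ∞ :=
        ne_top_of_le_ne_top hfin (ENNReal.tsum_le_tsum fun w => by split_ifs <;> simp)
      rw [hrest] at htot
      exact (ENNReal.add_left_inj hrestfin).1 htot
    · exact hstep y hy
  refine ⟨PMF.normalize m hne hfin, ?_⟩
  refine PMF.ext fun y => ?_
  simp only [PMF.bind_apply, PMF.normalize_apply]
  rw [← hinv y, ← ENNReal.tsum_mul_right]
  refine tsum_congr fun z => ?_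
  ring

/-- The mean of the decrease under a stationary law. -/
theorem IsStationary.expect_le_of_drift {ν : PMF α} (hν : IsStationary P ν) {V f : α → ℝ≥0∞}
    {b : ℝ≥0∞} (hV : ∀ x, V x ≠ ∞) (hdrift : ∀ x, expect (P x) V + f x ≤ V x + b) :
    expect ν f ≤ b := by
  classical
  -- `V` need not be integrable under `ν`. Its truncation at `M` is, so its mean cancels, and the
  -- drift survives truncation when `f` is kept only where `V ≤ M`.
  have htrunc : ∀ M : ℕ, expect ν (fun x => if V x ≤ M then f x else 0) ≤ b := by
    intro M
    have hpt : ∀ x, expect (P x) (fun y => min (V y) M) + (if V x ≤ M then f x else 0) ≤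
        min (V x) M + b := by
      intro x
      split_ifs with hx
      · rw [min_eq_left hx]
        exact (add_le_add_left (expect_mono fun y => min_le_left _ _) _).trans (hdrift x)
      · rw [min_eq_right (not_le.1 hx).le, add_zero]
        exact ((expect_mono fun y => min_le_right _ _).trans (expect_const (P x) _).le).trans
          le_self_add
    have hint := expect_mono (p := ν) hpt
    rw [expect_add, expect_add, expect_const, ← expect_bind,
      show ν.bind (fun x => P x) = ν from hν] at hint
    refine (ENNReal.add_le_add_iff_left ?_).1 hint
    refine ne_top_of_le_ne_top (ENNReal.natCast_ne_top M)
      ((expect_mono fun y => min_le_right _ _).trans (expect_const ν _).le)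
  rw [expect, ENNReal.tsum_eq_iSup_sum]
  refine iSup_le fun t => ?_
  obtain ⟨M, hM⟩ : ∃ M : ℕ, ∀ x ∈ t, V x ≤ M := by
    obtain ⟨M, hM⟩ := ENNReal.exists_nat_gt (ENNReal.sum_ne_top.2 fun x (_ : x ∈ t) => hV x)
    exact ⟨M, fun x hx => (Finset.single_le_sum (f := V) (fun _ _ => zero_le) hx).trans hM.le⟩
  refine le_trans ?_ (htrunc M)
  refine le_trans (Finset.sum_le_sum fun x hx => ?_) (ENNReal.sum_le_tsum t)
  simp [hM x hx]

end Stationary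

/-- The Foster–Lyapunov criterion, for a chain that need not be irreducible. -/
theorem foster [Nonempty α] {P : α → PMF α} {V f : α → ℝ≥0∞} {b : ℝ≥0∞} (hV : ∀ x, V x ≠ ∞)
    (hb : b ≠ ∞) (hdrift : ∀ x, expect (P x) V + f x ≤ V x + b) (hf : {x | f x ≤ b + 1}.Finite) :
    IsPosRecurrent P ∧ (∃ ν, IsStationary P ν) ∧ ∀ ν, IsStationary P ν → expect ν f ≤ b := by
  -- Where `f > b + 1`, the mean of `V` drops by at least one.
  have hF : ∀ x, meanReturnTime P {x | f x ≤ b + 1} x < ∞ := by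
    intro x
    refine (meanReturnTime_le_of_drift (V := V) (fun x hx => ?_) x).trans_lt ?_
    · have hx : b + 1 < f x := not_le.1 hx
      have h := (add_le_add_right hx.le (expect (P x) V)).trans (hdrift x)
      rw [add_comm b 1, ← add_assoc] at h
      exact (ENNReal.add_le_add_iff_right hb).1 h
    · exact ENNReal.add_lt_top.2 ⟨ENNReal.one_lt_top, (le_self_add.trans (hdrift x)).trans_lt
        (ENNReal.add_lt_top.2 ⟨(hV x).lt_top, hb.lt_top⟩)⟩
  have hess := exists_reaches_essential hf fun x => exists_reaches_of_meanReturnTime_lt_top (hF x)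
  have hpos : ∀ x, IsEssential P x → IsPosRecState P x := fun x hx =>
    hx.isPosRecState hf hF
  refine ⟨⟨hpos, ?_⟩, ?_, fun ν hν => hν.expect_le_of_drift hV hdrift⟩
  · refine meanReturnTime_lt_top_of_finite hf (fun z _ => ?_) hF
    obtain ⟨y, hy, hzy⟩ := hess z
    exact ⟨y, hpos y hy, hzy⟩
  · obtain ⟨y, hy, -⟩ := hess (Classical.arbitrary α)
    exact (hpos y hy).exists_stationary

end MarkovChain

namespace MarkovChain

/-! ### The Poisson equation on a finite state space. -/

section FiniteChain

variable {S : Type*} [Fintype S]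

theorem sum_toReal (p : PMF S) : ∑ s, (p s).toReal = 1 := by
  have h := p.tsum_coe
  rw [tsum_fintype] at h
  rw [← ENNReal.toReal_sum fun s _ => p.apply_ne_top s, h, ENNReal.toReal_one]

theorem expect_ofReal (p : PMF S) {f : S → ℝ} (hf : ∀ s, 0 ≤ f s) :
    expect p (fun s => ENNReal.ofReal (f s)) = ENNReal.ofReal (∑ s, (p s).toReal * f s) := by
  rw [expect, tsum_fintype, ENNReal.ofReal_sum_of_nonneg
    fun s _ => mul_nonneg ENNReal.toReal_nonneg (hf s)]
  refine Finset.sum_congr rfl fun s _ => ?_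
  rw [ENNReal.ofReal_mul ENNReal.toReal_nonneg, ENNReal.ofReal_toReal (p.apply_ne_top s)]

/-- A harmonic function of a finite irreducible chain is constant. -/
theorem IsIrreducible.harmonic_const {P : S → PMF S} (hP : IsIrreducible P) {h : S → ℝ}
    (hh : ∀ s, h s = ∑ s', (P s s').toReal * h s') (s t : S) : h s = h t := by
  have : Nonempty S := ⟨s⟩
  obtain ⟨m, hm⟩ := Finite.exists_max h
  -- Maximum principle: an average equal to the maximum is an average of maximal values, so the set
  -- of maximizers is closed under steps.
  have hcl : ∀ x ∈ {x | h x = h m}, ∀ y, P x y ≠ 0 → y ∈ {x | h x = h m} := by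
    intro x hx y hy
    by_contra hne
    have hlt : h y < h m := lt_of_le_of_ne (hm y) hne
    have h1 : ∑ s', (P x s').toReal * h s' < ∑ s', (P x s').toReal * h m :=
      Finset.sum_lt_sum (fun i _ => mul_le_mul_of_nonneg_left (hm i) ENNReal.toReal_nonneg)
        ⟨y, Finset.mem_univ _, mul_lt_mul_of_pos_left hlt
          (ENNReal.toReal_pos hy ((P x).apply_ne_top y))⟩
    rw [← Finset.sum_mul, sum_toReal, one_mul, ← hh x] at h1
    exact h1.ne hx
  have key : ∀ y, h y = h m := fun y => (hP m y).mem_of_closed hcl rfl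
  rw [key s, key t]

theorem IsStationary.sum_step {P : S → PMF S} {π : PMF S} (hπ : IsStationary P π) (g : S → ℝ) :
    ∑ s, (π s).toReal * ∑ s', (P s s').toReal * g s' = ∑ s, (π s).toReal * g s := by
  have h : ∀ s', ∑ s, (π s).toReal * (P s s').toReal = (π s').toReal := by
    intro s'
    conv_rhs => rw [← show π.bind P = π from hπ, PMF.bind_apply, tsum_fintype,
      ENNReal.toReal_sum fun s _ => ENNReal.mul_ne_top (π.apply_ne_top s) ((P s).apply_ne_top s')]
    simp only [ENNReal.toReal_mul]
  simp only [Finset.mul_sum, ← mul_assoc]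
  rw [Finset.sum_comm]
  simp only [← Finset.sum_mul, h]

/-- Solvability of the Poisson equation. -/
theorem exists_poisson {P : S → PMF S} {π : PMF S} (hP : IsIrreducible P)
    (hπ : IsStationary P π) {f : S → ℝ} (hf : ∑ s, (π s).toReal * f s = 0) :
    ∃ h : S → ℝ, ∀ s, h s - ∑ s', (P s s').toReal * h s' = f s := by
  have : Nonempty S := ⟨π.support_nonempty.some⟩
  let A : (S → ℝ) →ₗ[ℝ] (S → ℝ) :=
    { toFun := fun h s => h s - ∑ s', (P s s').toReal * h s'
      map_add' := fun g h => by
        ext s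
        simp only [Pi.add_apply, mul_add, Finset.sum_add_distrib]
        ring
      map_smul' := fun c h => by
        ext s
        simp only [Pi.smul_apply, smul_eq_mul, RingHom.id_apply, mul_sub, Finset.mul_sum]
        congr 1
        exact Finset.sum_congr rfl fun _ _ => by ring }
  let φ : (S → ℝ) →ₗ[ℝ] ℝ :=
    { toFun := fun g => ∑ s, (π s).toReal * g s
      map_add' := fun g h => by simp only [Pi.add_apply, mul_add, Finset.sum_add_distrib]
      map_smul' := fun c h => by
        simp only [Pi.smul_apply, smul_eq_mul, RingHom.id_apply, Finset.mul_sum]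
        exact Finset.sum_congr rfl fun _ _ => by ring }
  -- Dimension count: stationarity puts `range A` inside `ker φ`; harmonic functions are constant,
  -- so `A` has corank at most one, which is the codimension of `ker φ`. Hence the two subspaces
  -- agree.
  have hle : LinearMap.range A ≤ LinearMap.ker φ := by
    rintro _ ⟨h, rfl⟩
    change ∑ s, (π s).toReal * (h s - ∑ s', (P s s').toReal * h s') = 0
    simp only [mul_sub, Finset.sum_sub_distrib]
    rw [hπ.sum_step, sub_self]
  have hφ : LinearMap.range φ = ⊤ := by
    refine LinearMap.range_eq_top.2 fun c => ⟨fun _ => c, ?_⟩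
    change ∑ s, (π s).toReal * c = c
    rw [← Finset.sum_mul, sum_toReal, one_mul]
  have hker : Module.finrank ℝ (LinearMap.ker A) ≤ 1 := by
    refine finrank_le_one (⟨fun _ => 1, ?_⟩ : LinearMap.ker A) ?_
    · refine LinearMap.mem_ker.2 (funext fun s => ?_)
      change (1 : ℝ) - ∑ s', (P s s').toReal * 1 = 0
      simp [sum_toReal]
    · rintro ⟨h, hh⟩
      obtain ⟨s₀⟩ := this
      refine ⟨h s₀, Subtype.ext (funext fun s => ?_)⟩
      have := hP.harmonic_const (h := h) (fun s => sub_eq_zero.1 (congrFun (LinearMap.mem_ker.1 hh) s)) s₀ s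
      simpa using this
  have h1 := LinearMap.finrank_range_add_finrank_ker A
  have h2 := LinearMap.finrank_range_add_finrank_ker φ
  rw [hφ, finrank_top, Module.finrank_self] at h2
  have heq := Submodule.eq_of_le_of_finrank_le hle (by omega)
  have hmem : f ∈ LinearMap.range A := heq ▸ LinearMap.mem_ker.2 hf
  obtain ⟨h, hh⟩ := hmem
  exact ⟨h, fun s => congrFun hh s⟩

end FiniteChain

end MarkovChain

/-! ### Visit counts and the mismatch. -/

namespace Topology

open MarkovChain

variable {S : Type*}

theorem length_of_mem_walkPath {P : S → PMF S} {n : ℕ} {s : S} {l : List S}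
    (hl : l ∈ (walkPath P n s).support) : l.length = n := by
  induction n generalizing s l with
  | zero => simpa [walkPath] using hl
  | succ n ih =>
    simp only [walkPath, PMF.mem_support_bind_iff, PMF.mem_support_map_iff] at hl
    obtain ⟨s', -, l', hl', rfl⟩ := hl
    simp [ih hl']

/-- Independent topologies are a walk with constant kernel, so one variance estimate serves both
marginals. -/
theorem iidPath_eq_walkPath (π : PMF S) (n : ℕ) :
    iidPath π n = π.bind (walkPath (fun _ => π) n) := by
  induction n with
  | zero => simp [iidPath, walkPath]
  | succ n ih =>
    simp only [iidPath, walkPath, ih, PMF.map_bind]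

theorem sum_map_indicator_sub [DecidableEq S] (l : List S) (s : S) (c : ℝ) :
    (l.map fun t => (if t = s then (1 : ℝ) else 0) - c).sum = l.count s - l.length * c := by
  induction l with
  | nil => simp
  | cons t l ih =>
    rw [List.map_cons, List.sum_cons, ih, List.count_cons, List.length_cons]
    by_cases h : t = s <;> simp [h] <;> ring

variable [Fintype S]

/-- Second moments of the sums along a walk of a function with a solved Poisson equation. -/
theorem expect_walkPath_sq_le {P : S → PMF S} {f h : S → ℝ} {H : ℝ}
    (hfh : ∀ s, h s - ∑ s', (P s s').toReal * h s' = f s) (hH : ∀ s, (h s) ^ 2 ≤ H) (n : ℕ) (s : S)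
    (a : ℝ) :
    expect (walkPath P n s) (fun l => ENNReal.ofReal ((a + (l.map f).sum) ^ 2)) ≤
      ENNReal.ofReal (2 * (a + h s) ^ 2 + n * (2 * H) + 2 * H) := by
  have hH0 : 0 ≤ H := (sq_nonneg _).trans (hH s)
  induction n generalizing s a with
  | zero =>
    rw [walkPath, expect_pure]
    refine ENNReal.ofReal_le_ofReal ?_
    simp only [List.map_nil, List.sum_nil, Nat.cast_zero]
    -- `2 * (a + h s) ^ 2 + 2 * h s ^ 2 - a ^ 2 = (a + 2 * h s) ^ 2`; this is the origin of the
    -- factor 2 in the bound.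
    nlinarith [hH s, sq_nonneg (a + 2 * h s)]
  | succ n ih =>
    rw [walkPath, expect_bind]
    simp only [expect_map, List.map_cons, List.sum_cons, ← add_assoc]
    refine (expect_mono fun s' => ih s' (a + f s)).trans ?_
    rw [expect_ofReal _ fun s' => by positivity]
    refine ENNReal.ofReal_le_ofReal ?_
    -- The next value `a + f s + h s'` has mean `a + h s` (martingale), and its variance is at most
    -- `H`.
    have hmean : ∑ s', (P s s').toReal * h s' = h s - f s := by linarith [hfh s]
    have hsq : ∑ s', (P s s').toReal * (h s') ^ 2 ≤ H := by
      calc _ ≤ ∑ s', (P s s').toReal * H :=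
            Finset.sum_le_sum fun i _ => mul_le_mul_of_nonneg_left (hH i) ENNReal.toReal_nonneg
        _ = H := by rw [← Finset.sum_mul, sum_toReal, one_mul]
    have hexp : ∑ s', (P s s').toReal * (2 * (a + f s + h s') ^ 2 + n * (2 * H) + 2 * H) =
        (2 * (a + f s) ^ 2 + n * (2 * H) + 2 * H) * ∑ s', (P s s').toReal +
          4 * (a + f s) * ∑ s', (P s s').toReal * h s' +
          2 * ∑ s', (P s s').toReal * (h s') ^ 2 := by
      simp only [Finset.mul_sum, ← Finset.sum_add_distrib]
      exact Finset.sum_congr rfl fun _ _ => by ring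
    rw [hexp, sum_toReal, hmean]
    push_cast
    nlinarith [sq_nonneg (h s - f s)]

variable [DecidableEq S]

theorem sum_mul_indicator_sub (π : PMF S) (s : S) :
    ∑ t, (π t).toReal * ((if t = s then (1 : ℝ) else 0) - (π s).toReal) = 0 := by
  simp only [mul_sub, Finset.sum_sub_distrib, ← Finset.sum_mul, sum_toReal]
  simp

/-- Second moments of the deviations of the numbers of visits grow linearly. -/
theorem exists_expect_walkPath_le {P : S → PMF S} {π : PMF S}
    (hsol : ∀ s, ∃ h : S → ℝ, ∀ t, h t - ∑ t', (P t t').toReal * h t' =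
      (if t = s then (1 : ℝ) else 0) - (π s).toReal) :
    ∃ C : ℝ, 0 ≤ C ∧ ∀ (T : ℕ) (ρ : PMF S) (s : S),
      expect (ρ.bind (walkPath P T))
        (fun l => ENNReal.ofReal (((l.count s : ℝ) - l.length * (π s).toReal) ^ 2)) ≤
      ENNReal.ofReal (C * (T + 1)) := by
  choose h hh using hsol
  set H := ∑ s, ∑ t, (h s t) ^ 2 with hHdef
  have hH : ∀ s t, (h s t) ^ 2 ≤ H := fun s t =>
    (Finset.single_le_sum (f := fun t => (h s t) ^ 2) (fun _ _ => sq_nonneg _)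
      (Finset.mem_univ t)).trans
      (Finset.single_le_sum (f := fun s => ∑ t, (h s t) ^ 2)
        (fun _ _ => Finset.sum_nonneg fun _ _ => sq_nonneg _) (Finset.mem_univ s))
  have hH0 : 0 ≤ H := Finset.sum_nonneg fun _ _ => Finset.sum_nonneg fun _ _ => sq_nonneg _
  refine ⟨4 * H, by positivity, fun T ρ s => ?_⟩
  rw [expect_bind]
  refine (expect_mono fun t => ?_).trans (expect_const ρ _).le
  have key := expect_walkPath_sq_le (hh s) (hH s) T t 0
  simp only [sum_map_indicator_sub, zero_add] at key
  refine key.trans (ENNReal.ofReal_le_ofReal ?_)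
  nlinarith [hH s t, mul_nonneg (Nat.cast_nonneg (α := ℝ) T) hH0]

/-- Both counts are compared with the same centre `l.length * c s`, and `|z| ≤ z ^ 2 / κ + κ` makes
second moments applicable. -/
theorem mismatch_le {l l' : List S} (hl : l.length = l'.length) {κ : ℝ} (hκ : 0 < κ)
    (c : S → ℝ) :
    (mismatch l l' : ℝ) ≤ ∑ s, (((l.count s : ℝ) - l.length * c s) ^ 2 * κ⁻¹ +
      ((l'.count s : ℝ) - l'.length * c s) ^ 2 * κ⁻¹ + 2 * κ) := by
  rw [mismatch, Nat.cast_sum]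
  refine Finset.sum_le_sum fun s _ => ?_
  have habs : ∀ z : ℝ, |z| ≤ z ^ 2 * κ⁻¹ + κ := by
    intro z
    rw [← div_eq_mul_inv, ← sub_le_iff_le_add, le_div_iff₀ hκ, ← sq_abs]
    nlinarith [sq_nonneg (|z| - κ), abs_nonneg z]
  have h1 := habs ((l.count s : ℝ) - l.length * c s)
  have h2 := habs ((l'.count s : ℝ) - l'.length * c s)
  have h3 : ((l.count s - l'.count s : ℕ) : ℝ) ≤
      |(l.count s : ℝ) - l.length * c s| + |(l'.count s : ℝ) - l'.length * c s| := by
    rcases le_total (l.count s) (l'.count s) with h | h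
    · rw [Nat.sub_eq_zero_of_le h, Nat.cast_zero]
      positivity
    · rw [Nat.cast_sub h, hl]
      have e1 := le_abs_self ((l.count s : ℝ) - l'.length * c s)
      have e2 := neg_abs_le ((l'.count s : ℝ) - l'.length * c s)
      linarith
  linarith

/-- The expected mismatch per slot tends to zero, uniformly over all couplings. -/
theorem exists_meanMismatch_lt {P : S → PMF S} {π : PMF S} (hP : IsIrreducible P)
    (hπ : IsStationary P π) {η : ℝ} (hη : 0 < η) :
    ∃ T₀ : ℕ, ∀ T ≥ T₀, ∀ (ρ : PMF S) (γ : PMF (List S × List S)),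
      IsFrameCoupling P π T ρ γ → meanMismatch T γ < η := by
  -- For the constant kernel `π` a centred function solves its own Poisson equation.
  obtain ⟨C₁, hC₁, h₁⟩ := exists_expect_walkPath_le (P := fun _ : S => π) (π := π) fun s =>
    ⟨fun t => (if t = s then (1 : ℝ) else 0) - (π s).toReal, fun t => by
      rw [sum_mul_indicator_sub, sub_zero]⟩
  obtain ⟨C₂, hC₂, h₂⟩ := exists_expect_walkPath_le (P := P) (π := π) fun s =>
    exists_poisson hP hπ (sum_mul_indicator_sub π s)
  set m : ℝ := (Fintype.card S : ℝ) with hm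
  have hm0 : 0 ≤ m := Nat.cast_nonneg _
  -- With `κ = δ * T` the terms `2 * κ` add up to at most `η / 2 * T`. The variance terms stay
  -- bounded in `T`, and `T₀` puts them below the other half.
  set δ : ℝ := η / (4 * (m + 1)) with hδ
  have hδ0 : 0 < δ := by positivity
  obtain ⟨T₀, hT₀⟩ := exists_nat_gt (m * (2 * (C₁ + C₂)) / δ * 2 / η)
  refine ⟨T₀ + 1, fun T hT ρ γ hγ => ?_⟩
  have hT1 : (1 : ℝ) ≤ T := by exact_mod_cast (by omega : 1 ≤ T)
  have hTT : (T₀ : ℝ) ≤ T := by exact_mod_cast (by omega : T₀ ≤ T)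
  have hT0 : (0 : ℝ) < T := by linarith
  have hκ : 0 < δ * T := by positivity
  have hfst : ∀ s, expect γ (fun p =>
      ENNReal.ofReal (((p.1.count s : ℝ) - p.1.length * (π s).toReal) ^ 2)) ≤
      ENNReal.ofReal (C₁ * (T + 1)) := fun s => by
    have := h₁ T π s
    rwa [← iidPath_eq_walkPath, ← hγ.iid, expect_map] at this
  have hsnd : ∀ s, expect γ (fun p =>
      ENNReal.ofReal (((p.2.count s : ℝ) - p.2.length * (π s).toReal) ^ 2)) ≤
      ENNReal.ofReal (C₂ * (T + 1)) := fun s => by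
    have := h₂ T ρ s
    rwa [← hγ.walk, expect_map] at this
  have hlen : ∀ p ∈ γ.support, p.1.length = p.2.length := by
    intro p hp
    have e1 : p.1 ∈ (γ.map Prod.fst).support := (PMF.mem_support_map_iff _ _ _).2 ⟨p, hp, rfl⟩
    have e2 : p.2 ∈ (γ.map Prod.snd).support := (PMF.mem_support_map_iff _ _ _).2 ⟨p, hp, rfl⟩
    rw [hγ.iid, iidPath_eq_walkPath, PMF.mem_support_bind_iff] at e1
    rw [hγ.walk, PMF.mem_support_bind_iff] at e2
    obtain ⟨_, -, e1⟩ := e1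
    obtain ⟨_, -, e2⟩ := e2
    rw [length_of_mem_walkPath e1, length_of_mem_walkPath e2]
  have hE : expect γ (fun p => (mismatch p.1 p.2 : ℝ≥0∞)) ≤ ENNReal.ofReal
      (m * (C₁ * (T + 1) * (δ * T)⁻¹ + C₂ * (T + 1) * (δ * T)⁻¹ + 2 * (δ * T))) := by
    have hpt : ∀ p ∈ γ.support, (mismatch p.1 p.2 : ℝ≥0∞) ≤
        ∑ s, (ENNReal.ofReal (((p.1.count s : ℝ) - p.1.length * (π s).toReal) ^ 2) *
          ENNReal.ofReal (δ * T)⁻¹ +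
          ENNReal.ofReal (((p.2.count s : ℝ) - p.2.length * (π s).toReal) ^ 2) *
          ENNReal.ofReal (δ * T)⁻¹ + ENNReal.ofReal (2 * (δ * T))) := by
      intro p hp
      rw [← ENNReal.ofReal_natCast]
      refine (ENNReal.ofReal_le_ofReal (mismatch_le (hlen p hp) hκ
        fun s => (π s).toReal)).trans (le_of_eq ?_)
      rw [ENNReal.ofReal_sum_of_nonneg fun s _ => by positivity]
      refine Finset.sum_congr rfl fun s _ => ?_
      rw [ENNReal.ofReal_add (by positivity) (by positivity),
        ENNReal.ofReal_add (by positivity) (by positivity),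
        ENNReal.ofReal_mul (by positivity), ENNReal.ofReal_mul (by positivity)]
    refine (expect_mono_support hpt).trans ?_
    rw [expect_finset_sum]
    simp only [expect_add, expect_mul_const, expect_const]
    refine (Finset.sum_le_sum fun s _ => add_le_add (add_le_add (mul_le_mul_left (hfst s) _)
      (mul_le_mul_left (hsnd s) _)) le_rfl).trans (le_of_eq ?_)
    rw [Finset.sum_const, Finset.card_univ, nsmul_eq_mul, ENNReal.ofReal_mul hm0, hm,
      ENNReal.ofReal_natCast, ENNReal.ofReal_add (by positivity) (by positivity),
      ENNReal.ofReal_add (by positivity) (by positivity),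
      ENNReal.ofReal_mul (p := C₁ * (T + 1)) (by positivity),
      ENNReal.ofReal_mul (p := C₂ * (T + 1)) (by positivity)]
  have hR := ENNReal.toReal_le_of_le_ofReal (by positivity) hE
  rw [meanMismatch, div_lt_iff₀ hT0]
  refine hR.trans_lt ?_
  have hTT' : m * (2 * (C₁ + C₂)) / δ < η / 2 * T := by
    have := hT₀.trans_le hTT
    rw [div_lt_iff₀ hη] at this
    linarith
  have hmδ : m * δ ≤ η / 4 := by
    rw [hδ, mul_div_assoc', div_le_div_iff₀ (by positivity) (by positivity)]
    nlinarith
  have hfrac : ((T : ℝ) + 1) * (δ * T)⁻¹ ≤ 2 / δ := by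
    rw [← div_eq_mul_inv, div_le_div_iff₀ hκ hδ0]
    nlinarith
  have e1 : m * (C₁ * (T + 1) * (δ * T)⁻¹ + C₂ * (T + 1) * (δ * T)⁻¹ + 2 * (δ * T)) =
      m * (C₁ + C₂) * ((T + 1) * (δ * T)⁻¹) + 2 * (m * δ) * T := by ring
  have e2 : m * (C₁ + C₂) * ((T + 1) * (δ * T)⁻¹) ≤ m * (C₁ + C₂) * (2 / δ) :=
    mul_le_mul_of_nonneg_left hfrac (by positivity)
  have e3 : m * (C₁ + C₂) * (2 / δ) = m * (2 * (C₁ + C₂)) / δ := by ring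
  rw [e1]
  nlinarith [mul_le_mul_of_nonneg_right hmδ hT0.le]

end Topology

/-! ### Size and distance of queue states. -/

namespace Queues

variable {N : ℕ}

/-- The number of packets and power units in all the queues. -/
def total (q : Queues N) : ℝ := ∑ i, ((q.X i : ℝ) + q.Y i + q.U i)

/-- No queue differs by more than `r`. -/
def Near (r : ℝ) (p q : Queues N) : Prop :=
  ∀ i, |(p.X i : ℝ) - q.X i| ≤ r ∧ |(p.Y i : ℝ) - q.Y i| ≤ r ∧ |(p.U i : ℝ) - q.U i| ≤ r

/-- The state without packets. -/
def empty : Queues N := ⟨fun _ => 0, fun _ => 0, fun _ => 0⟩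

theorem Near.mono {r r' : ℝ} (h : r ≤ r') {p q : Queues N} (hpq : Near r p q) : Near r' p q :=
  fun i => ⟨(hpq i).1.trans h, (hpq i).2.1.trans h, (hpq i).2.2.trans h⟩

theorem Near.trans {r r' : ℝ} {p q w : Queues N} (h : Near r p q) (h' : Near r' q w) :
    Near (r + r') p w := fun i =>
  ⟨(abs_sub_le _ _ _).trans (add_le_add (h i).1 (h' i).1),
    (abs_sub_le _ _ _).trans (add_le_add (h i).2.1 (h' i).2.1),
    (abs_sub_le _ _ _).trans (add_le_add (h i).2.2 (h' i).2.2)⟩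

theorem Near.refl (q : Queues N) : Near 0 q q := fun i => by simp

theorem total_nonneg (q : Queues N) : 0 ≤ q.total := Finset.sum_nonneg fun _ _ => by positivity

theorem le_total (q : Queues N) (i : Fin N) : (q.X i : ℝ) + q.Y i + q.U i ≤ q.total :=
  Finset.single_le_sum (f := fun i => (q.X i : ℝ) + q.Y i + q.U i) (fun _ _ => by positivity)
    (Finset.mem_univ i)

theorem near_empty (q : Queues N) : Near q.total q empty := fun i => by
  have h := q.le_total i
  have h1 : (0 : ℝ) ≤ q.X i := Nat.cast_nonneg _
  have h2 : (0 : ℝ) ≤ q.Y i := Nat.cast_nonneg _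
  have h3 : (0 : ℝ) ≤ q.U i := Nat.cast_nonneg _
  simp only [empty, Nat.cast_zero, sub_zero, Nat.abs_cast]
  exact ⟨by linarith, by linarith, by linarith⟩

theorem finite_total_le (c : ℝ) : {q : Queues N | q.total ≤ c}.Finite := by
  obtain ⟨M, hM⟩ := exists_nat_ge c
  have hfin : (Set.pi Set.univ fun _ : Fin N => Set.Iic M).Finite :=
    Set.Finite.pi fun _ => Set.finite_Iic M
  have hinj : Function.Injective fun q : Queues N => (q.X, q.Y, q.U) := by
    rintro ⟨X, Y, U⟩ ⟨X', Y', U'⟩ h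
    simpa using h
  refine ((hfin.prod (hfin.prod hfin)).preimage hinj.injOn).subset fun q hq => ?_
  have key : ∀ i, q.X i + q.Y i + q.U i ≤ M := fun i => by
    have := ((q.le_total i).trans hq).trans hM
    exact_mod_cast this
  simp only [Set.mem_preimage, Set.mem_prod, Set.mem_pi, Set.mem_univ, Set.mem_Iic, true_imp_iff]
  exact ⟨fun i => by have := key i; omega, fun i => by have := key i; omega,
    fun i => by have := key i; omega⟩

end Queues

/-! ### Change of the queues and of the energy in one slot. -/

namespace RelayNetwork

open MarkovChain Queues

variable {N : ℕ} {S K : Type*} (net : RelayNetwork N S K)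

theorem abs_weight_sub_le {r : ℝ} {p q : Queues N} (h : Near r p q) (s : S) (k : K) :
    |net.weight p s k - net.weight q s k| ≤
      (∑ _i : Fin N, ((∑ _j : Fin N, 2 * (net.rateMax : ℝ)) + net.rateMax +
        net.powerUnit * net.powerMax)) * r := by
  rw [weight, weight, ← Finset.sum_sub_distrib, Finset.sum_mul]
  refine (Finset.abs_sum_le_sum_abs _ _).trans (Finset.sum_le_sum fun i _ => ?_)
  have hr : 0 ≤ r := (abs_nonneg _).trans (h i).1
  have hrate : ∀ d, (net.rate s k i d : ℝ) ≤ net.rateMax := fun d => by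
    exact_mod_cast net.rate_le s k i d
  have hpow : net.usedPower k i ≤ net.powerMax := net.power_le k i
  have hpow0 : 0 ≤ net.usedPower k i := mul_nonneg net.powerUnit_pos.le (Nat.cast_nonneg _)
  have hpu := net.powerUnit_pos.le
  have h1 : |(∑ j with j ≠ i, ((p.X i : ℝ) - p.Y j) * net.rate s k i (some j)) -
      ∑ j with j ≠ i, ((q.X i : ℝ) - q.Y j) * net.rate s k i (some j)| ≤
      (∑ _j : Fin N, 2 * (net.rateMax : ℝ)) * r := by
    rw [← Finset.sum_sub_distrib, Finset.sum_mul]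
    refine (Finset.abs_sum_le_sum_abs _ _).trans ((Finset.sum_le_sum fun j _ => ?_).trans
      (Finset.sum_le_sum_of_subset_of_nonneg (Finset.filter_subset _ _)
        fun _ _ _ => by positivity))
    rw [← sub_mul, abs_mul, Nat.abs_cast]
    have : |(p.X i : ℝ) - p.Y j - (q.X i - q.Y j)| ≤ 2 * r := by
      have e1 := abs_le.1 (h i).1
      have e2 := abs_le.1 (h j).2.1
      rw [abs_le]
      constructor <;> linarith [e1.1, e1.2, e2.1, e2.2]
    calc _ ≤ 2 * r * net.rateMax := mul_le_mul this (hrate _) (Nat.cast_nonneg _) (by positivity)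
      _ = _ := by ring
  have h2 : |max (p.X i : ℝ) (p.Y i) * net.rate s k i none -
      max (q.X i : ℝ) (q.Y i) * net.rate s k i none| ≤ net.rateMax * r := by
    rw [← sub_mul, abs_mul, Nat.abs_cast, mul_comm (net.rateMax : ℝ)]
    exact mul_le_mul ((abs_max_sub_max_le_max _ _ _ _).trans (max_le (h i).1 (h i).2.1))
      (hrate _) (Nat.cast_nonneg _) hr
  have h3 : |net.powerUnit * p.U i * net.usedPower k i -
      net.powerUnit * q.U i * net.usedPower k i| ≤ net.powerUnit * net.powerMax * r := by
    rw [← sub_mul, ← mul_sub, abs_mul, abs_mul, abs_of_nonneg hpu, abs_of_nonneg hpow0,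
      mul_right_comm]
    exact mul_le_mul (mul_le_mul_of_nonneg_left hpow hpu) (h i).2.2 (abs_nonneg _)
      (mul_nonneg hpu (hpow0.trans hpow))
  rw [add_mul, add_mul]
  rw [abs_le] at h1 h2 h3 ⊢
  constructor <;> linarith [h1.1, h1.2, h2.1, h2.2, h3.1, h3.2]

theorem weight_empty (s : S) (k : K) : net.weight empty s k = 0 := by
  simp [weight, empty]

/-- The sum of the squares of the queues. -/
def energy (q : Queues N) : ℝ :=
  ∑ i, ((q.X i : ℝ) ^ 2 + (q.Y i : ℝ) ^ 2 + (net.powerUnit * q.U i) ^ 2)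

/-- A bound on the change of each queue in a slot. -/
def stepBound [Fintype K] (Amax : ℕ) : ℕ :=
  Amax + net.rateMax + N * net.rateMax + ∑ i, net.budgetCount i + ∑ k, ∑ i, net.usedCount k i

/-- The capacity offered to own queue `i` in a slot. -/
def ownService (s : S) (k : K) (own : Fin N → Bool) (i : Fin N) : ℕ :=
  (if own i then net.rate s k i none else 0) + ∑ j with j ≠ i, net.rate s k i (some j)

/-- The capacity offered to relay queue `i` in a slot. -/
def relayService (s : S) (k : K) (own : Fin N → Bool) (i : Fin N) : ℕ :=
  if own i then 0 else net.rate s k i none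

/-- The capacity of the links into relay queue `i` in a slot. -/
def relayInflow (s : S) (k : K) (i : Fin N) : ℕ := ∑ j with j ≠ i, net.rate s k j (some i)

theorem sum_rate_le (s : S) (k : K) (g : Fin N → Fin N × Fin N) (i : Fin N) :
    ∑ j with j ≠ i, net.rate s k (g j).1 (some (g j).2) ≤ N * net.rateMax := by
  refine (Finset.sum_le_card_nsmul _ _ net.rateMax fun j _ => net.rate_le _ _ _ _).trans ?_
  rw [smul_eq_mul]
  exact Nat.mul_le_mul_right _ ((Finset.card_filter_le _ _).trans (by simp))

section Slot

variable [Fintype K] (Amax : ℕ)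

theorem ownService_le (s : S) (k : K) (own : Fin N → Bool) (i : Fin N) :
    net.ownService s k own i ≤ net.stepBound Amax := by
  have h1 := net.sum_rate_le s k (fun j => (i, j)) i
  have h2 := net.rate_le s k i none
  simp only [ownService, stepBound]
  simp only at h1
  split_ifs <;> omega

theorem relayService_le (s : S) (k : K) (own : Fin N → Bool) (i : Fin N) :
    net.relayService s k own i ≤ net.stepBound Amax := by
  have h2 := net.rate_le s k i none
  simp only [relayService, stepBound]
  split_ifs <;> omega

theorem relayInflow_le (s : S) (k : K) (i : Fin N) :
    net.relayInflow s k i ≤ net.stepBound Amax := by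
  have h1 := net.sum_rate_le s k (fun j => (j, i)) i
  simp only [relayInflow, stepBound]
  simp only at h1
  omega

theorem usedCount_le (k : K) (i : Fin N) : net.usedCount k i ≤ net.stepBound Amax := by
  have h1 : net.usedCount k i ≤ ∑ k, ∑ i, net.usedCount k i :=
    (Finset.single_le_sum (f := fun i => net.usedCount k i) (fun _ _ => Nat.zero_le _)
      (Finset.mem_univ i)).trans
      (Finset.single_le_sum (f := fun k => ∑ i, net.usedCount k i) (fun _ _ => Nat.zero_le _)
        (Finset.mem_univ k))
  simp only [stepBound]
  omega

theorem budgetCount_le (i : Fin N) : net.budgetCount i ≤ net.stepBound Amax := by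
  have h1 : net.budgetCount i ≤ ∑ i, net.budgetCount i :=
    Finset.single_le_sum (f := fun i => net.budgetCount i) (fun _ _ => Nat.zero_le _)
      (Finset.mem_univ i)
  simp only [stepBound]
  omega

end Slot

/-- Links that each draw from the full queue remove at least as much as one link with their total
capacity. -/
theorem min_sum_le {ι : Type*} (t : Finset ι) (x : ℕ) (r : ι → ℕ) :
    min x (∑ j ∈ t, r j) ≤ ∑ j ∈ t, min x (r j) := by
  classical
  induction t using Finset.induction_on with
  | empty => simp
  | insert i t hi ih =>
    rw [Finset.sum_insert hi, Finset.sum_insert hi]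
    omega

theorem sum_toRelay (q : Queues N) (s : S) (k : K) (i : Fin N) :
    ∑ j, net.toRelay q s k i j = ∑ j with j ≠ i, min (q.X i) (net.rate s k i (some j)) := by
  rw [Finset.sum_filter]
  refine Finset.sum_congr rfl fun j _ => ?_
  by_cases h : j = i <;> simp [toRelay, h]

theorem sum_toRelay_in_le (q : Queues N) (s : S) (k : K) (i : Fin N) :
    ∑ j, net.toRelay q s k j i ≤ net.relayInflow s k i := by
  rw [relayInflow, Finset.sum_filter]
  refine Finset.sum_le_sum fun j _ => ?_
  by_cases h : i = j
  · simp [toRelay, h]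
  · simp [toRelay, h, Ne.symm h]

theorem slot_X_le (q : Queues N) (s : S) (k : K) (own : Fin N → Bool) (a : Fin N → ℕ) (i : Fin N) :
    (net.slot q s k own a).X i ≤ q.X i - net.ownService s k own i + a i := by
  have h := min_sum_le {j : Fin N | j ≠ i} (q.X i) fun j => net.rate s k i (some j)
  simp only [slot, sum_toRelay, ownService, ownToBase]
  split_ifs <;> omega

theorem le_slot_X (q : Queues N) (s : S) (k : K) (own : Fin N → Bool) (a : Fin N → ℕ) (i : Fin N) :
    q.X i ≤ (net.slot q s k own a).X i + net.ownService s k own i := by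
  have h : ∑ j with j ≠ i, min (q.X i) (net.rate s k i (some j)) ≤
      ∑ j with j ≠ i, net.rate s k i (some j) :=
    Finset.sum_le_sum fun j _ => min_le_right _ _
  simp only [slot, sum_toRelay, ownService, ownToBase]
  split_ifs <;> omega

theorem slot_Y_le (q : Queues N) (s : S) (k : K) (own : Fin N → Bool) (a : Fin N → ℕ) (i : Fin N) :
    (net.slot q s k own a).Y i ≤ q.Y i - net.relayService s k own i + net.relayInflow s k i := by
  have h := net.sum_toRelay_in_le q s k i
  simp only [slot, relayService, relayToBase]
  split_ifs <;> omega

theorem le_slot_Y (q : Queues N) (s : S) (k : K) (own : Fin N → Bool) (a : Fin N → ℕ) (i : Fin N) :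
    q.Y i ≤ (net.slot q s k own a).Y i + net.relayService s k own i := by
  simp only [slot, relayService, relayToBase]
  split_ifs <;> omega

theorem slot_near [Fintype K] {Amax : ℕ} (q : Queues N) (s : S) (k : K) (own : Fin N → Bool)
    {a : Fin N → ℕ} (ha : ∀ i, a i ≤ Amax) : Near (net.stepBound Amax) (net.slot q s k own a) q := by
  have key : ∀ x y b : ℕ, x ≤ y + b → y ≤ x + b → |(x : ℝ) - y| ≤ b := by
    intro x y b h1 h2
    have h1' : (x : ℝ) ≤ y + b := by exact_mod_cast h1
    have h2' : (y : ℝ) ≤ x + b := by exact_mod_cast h2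
    rw [abs_le]
    constructor <;> linarith
  intro i
  have hA : a i ≤ net.stepBound Amax := (ha i).trans (by simp only [stepBound]; omega)
  have e1 := net.ownService_le Amax s k own i
  have e2 := net.relayService_le Amax s k own i
  have e3 := net.relayInflow_le Amax s k i
  have e4 := net.usedCount_le Amax k i
  have e5 := net.budgetCount_le Amax i
  refine ⟨key _ _ _ ?_ ?_, key _ _ _ ?_ ?_, key _ _ _ ?_ ?_⟩
  · have := net.slot_X_le q s k own a i
    omega
  · have := net.le_slot_X q s k own a i
    omega
  · have := net.slot_Y_le q s k own a i
    omega
  · have := net.le_slot_Y q s k own a i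
    omega
  · simp only [slot]
    omega
  · simp only [slot]
    omega

/-- Squaring `z - o + a` gives the cross term `z * (a - o)`, also when truncation is active.
Replacing `z` by the value `z₀` that the decision uses costs at most `R * B`. -/
theorem sq_le_of_step {z z' o a B : ℕ} {z₀ R : ℝ} (h : z' ≤ z - o + a) (ho : o ≤ B) (ha : a ≤ B)
    (hz : |(z : ℝ) - z₀| ≤ R) :
    (z' : ℝ) ^ 2 ≤ (z : ℝ) ^ 2 + 2 * (z₀ * ((a : ℝ) - o)) + 2 * ((B : ℝ) ^ 2 + R * B) := by
  have ho' : (o : ℝ) ≤ B := by exact_mod_cast ho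
  have ha' : (a : ℝ) ≤ B := by exact_mod_cast ha
  have ho0 : (0 : ℝ) ≤ o := Nat.cast_nonneg _
  have ha0 : (0 : ℝ) ≤ a := Nat.cast_nonneg _
  have hz0 : (0 : ℝ) ≤ z := Nat.cast_nonneg _
  have h1 : (z' : ℝ) ^ 2 ≤ (z : ℝ) ^ 2 + 2 * (z * ((a : ℝ) - o)) + (o ^ 2 + a ^ 2) := by
    rcases le_total o z with hoz | hoz
    · have : (z' : ℝ) ≤ z - o + a := by
        rw [← Nat.cast_sub hoz]
        exact_mod_cast h
      have hoz' : (o : ℝ) ≤ z := by exact_mod_cast hoz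
      nlinarith [pow_le_pow_left₀ (Nat.cast_nonneg z') this 2, mul_nonneg ho0 ha0]
    · have : (z' : ℝ) ≤ a := by
        have : z' ≤ a := by omega
        exact_mod_cast this
      nlinarith [pow_le_pow_left₀ (Nat.cast_nonneg z') this 2, sq_nonneg ((z : ℝ) - o),
        mul_nonneg hz0 ha0]
  have h2 : ((z : ℝ) - z₀) * ((a : ℝ) - o) ≤ R * B := by
    refine (le_abs_self _).trans ?_
    rw [abs_mul]
    refine mul_le_mul hz ?_ (abs_nonneg _) ((abs_nonneg _).trans hz)
    rw [abs_le]
    constructor <;> linarith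
  have h3 := pow_le_pow_left₀ ho0 ho' 2
  have h4 := pow_le_pow_left₀ ha0 ha' 2
  nlinarith

/-- The weight in terms of the capacities offered to the queues, when the longer queue is served
on the link to the base station. -/
theorem weight_eq_sum (q : Queues N) (s : S) (k : K) {own : Fin N → Bool}
    (h1 : ∀ i, own i = true → q.Y i ≤ q.X i) (h2 : ∀ i, own i = false → q.X i ≤ q.Y i) :
    net.weight q s k = ∑ i, ((q.X i : ℝ) * net.ownService s k own i +
      q.Y i * ((net.relayService s k own i : ℝ) - net.relayInflow s k i) -
      net.powerUnit ^ 2 * q.U i * net.usedCount k i) := by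
  have hswap : ∑ i, ∑ j with j ≠ i, (q.Y j : ℝ) * net.rate s k i (some j) =
      ∑ i, (q.Y i : ℝ) * net.relayInflow s k i := by
    simp only [relayInflow, Nat.cast_sum, Finset.mul_sum, Finset.sum_filter]
    rw [Finset.sum_comm]
    refine Finset.sum_congr rfl fun i _ => Finset.sum_congr rfl fun j _ => ?_
    by_cases h : i = j
    · simp [h]
    · simp [h, Ne.symm h]
  have hbase : ∀ i, max (q.X i : ℝ) (q.Y i) * net.rate s k i none =
      q.X i * ((if own i then net.rate s k i none else 0 : ℕ) : ℝ) +
      q.Y i * (net.relayService s k own i : ℝ) := by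
    intro i
    rw [relayService]
    cases h : own i
    · have : (q.X i : ℝ) ≤ q.Y i := by exact_mod_cast h2 i h
      simp [max_eq_right this]
    · have : (q.Y i : ℝ) ≤ q.X i := by exact_mod_cast h1 i h
      simp [max_eq_left this]
  have hl : net.weight q s k = ∑ i, ((q.X i : ℝ) * (∑ j with j ≠ i, net.rate s k i (some j) : ℕ) +
      max (q.X i : ℝ) (q.Y i) * net.rate s k i none -
      net.powerUnit ^ 2 * q.U i * net.usedCount k i) -
      ∑ i, ∑ j with j ≠ i, (q.Y j : ℝ) * net.rate s k i (some j) := by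
    rw [weight, ← Finset.sum_sub_distrib]
    refine Finset.sum_congr rfl fun i _ => ?_
    simp only [sub_mul, Finset.sum_sub_distrib, Nat.cast_sum, Finset.mul_sum, usedPower]
    ring
  rw [hl, hswap, ← Finset.sum_sub_distrib]
  refine Finset.sum_congr rfl fun i _ => ?_
  rw [hbase, ownService, Nat.cast_add]
  ring

/-- The change of the energy in a slot, in terms of the queues `q₀` that the decision is based
on. -/
theorem energy_slot_le [Fintype K] {Amax : ℕ} {R : ℝ} {q q₀ : Queues N} (hq : Near R q q₀) (s : S)
    (k : K) {own : Fin N → Bool} (h1 : ∀ i, own i = true → q₀.Y i ≤ q₀.X i)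
    (h2 : ∀ i, own i = false → q₀.X i ≤ q₀.Y i) {a : Fin N → ℕ} (ha : ∀ i, a i ≤ Amax) :
    net.energy (net.slot q s k own a) ≤ net.energy q +
      (∑ _i : Fin N, (2 + net.powerUnit ^ 2) *
        (2 * ((net.stepBound Amax : ℝ) ^ 2 + R * net.stepBound Amax))) +
      2 * ((∑ i, (q₀.X i : ℝ) * a i) - (∑ i, net.powerUnit * q₀.U i * net.budget i) -
        net.weight q₀ s k) := by
  rw [net.weight_eq_sum q₀ s k h1 h2, energy, energy, ← Finset.sum_sub_distrib,
    ← Finset.sum_sub_distrib, Finset.mul_sum, ← Finset.sum_add_distrib, ← Finset.sum_add_distrib]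
  refine Finset.sum_le_sum fun i _ => ?_
  have hA : a i ≤ net.stepBound Amax := (ha i).trans (by simp only [stepBound]; omega)
  have eX := sq_le_of_step (net.slot_X_le q s k own a i) (net.ownService_le Amax s k own i) hA
    (hq i).1
  have eY := sq_le_of_step (net.slot_Y_le q s k own a i) (net.relayService_le Amax s k own i)
    (net.relayInflow_le Amax s k i) (hq i).2.1
  have eU := sq_le_of_step (le_refl ((net.slot q s k own a).U i)) (net.budgetCount_le Amax i)
    (net.usedCount_le Amax k i) (hq i).2.2
  have eU' := mul_le_mul_of_nonneg_left eU (sq_nonneg net.powerUnit)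
  rw [budget]
  nlinarith

end RelayNetwork

/-! ### Means of arrivals, and the maximal weight with its corrector. -/

namespace MarkovChain

variable {α : Type*}

theorem summable_toReal (p : PMF α) : Summable fun a => (p a).toReal :=
  ENNReal.summable_toReal p.tsum_coe_ne_top

theorem hasSum_toReal (p : PMF α) : HasSum (fun a => (p a).toReal) 1 := by
  have h : ∑' a, (p a).toReal = 1 := by
    rw [← ENNReal.tsum_toReal_eq fun a => p.apply_ne_top a, p.tsum_coe, ENNReal.toReal_one]
  exact h ▸ (summable_toReal p).hasSum

theorem expect_ofReal_of_hasSum {p : PMF α} {g : α → ℝ} {c : ℝ} (hg : ∀ a ∈ p.support, 0 ≤ g a)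
    (hc : HasSum (fun a => (p a).toReal * g a) c) :
    expect p (fun a => ENNReal.ofReal (g a)) = ENNReal.ofReal c := by
  rw [← hc.tsum_eq, ENNReal.ofReal_tsum_of_nonneg _ hc.summable]
  · refine tsum_congr fun a => ?_
    rw [ENNReal.ofReal_mul ENNReal.toReal_nonneg, ENNReal.ofReal_toReal (p.apply_ne_top a)]
  · intro a
    by_cases ha : p a = 0
    · simp [ha]
    · exact mul_nonneg ENNReal.toReal_nonneg (hg a ((PMF.mem_support_iff _ _).2 ha))

end MarkovChain

open MarkovChain in
theorem hasSum_meanArrival {N : ℕ} {arr : PMF (Fin N → ℕ)} {Amax : ℕ}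
    (h : ∀ a ∈ arr.support, ∀ i, a i ≤ Amax) (i : Fin N) :
    HasSum (fun a => (arr a).toReal * (a i : ℝ)) (meanArrival arr i) := by
  refine Summable.hasSum (Summable.of_nonneg_of_le (fun a => by positivity) (fun a => ?_)
    ((summable_toReal arr).mul_right (Amax : ℝ)))
  by_cases ha : arr a = 0
  · simp [ha]
  · refine mul_le_mul_of_nonneg_left ?_ ENNReal.toReal_nonneg
    exact_mod_cast h a ((PMF.mem_support_iff _ _).2 ha) i

namespace RelayNetwork

open MarkovChain Queues

variable {N : ℕ} {S K : Type*} (net : RelayNetwork N S K)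

/-- Centred arrivals have mean zero. The sign condition is needed because `ENNReal.ofReal` cuts off
negative values. -/
theorem expect_arrivals {arr : PMF (Fin N → ℕ)} {Amax : ℕ}
    (h : ∀ a ∈ arr.support, ∀ i, a i ≤ Amax) (c : ℝ) (β : Fin N → ℝ)
    (hpos : ∀ a ∈ arr.support, 0 ≤ c + ∑ i, β i * ((a i : ℝ) - meanArrival arr i)) :
    expect arr (fun a => ENNReal.ofReal (c + ∑ i, β i * ((a i : ℝ) - meanArrival arr i))) =
      ENNReal.ofReal c := by
  refine expect_ofReal_of_hasSum hpos ?_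
  have h1 : HasSum (fun a => ∑ i, β i * ((arr a).toReal * (a i : ℝ) -
      (arr a).toReal * meanArrival arr i)) (∑ i, β i * (meanArrival arr i -
        1 * meanArrival arr i)) :=
    hasSum_sum fun i _ => ((hasSum_meanArrival h i).sub
      ((hasSum_toReal arr).mul_right _)).mul_left _
  have h2 := ((hasSum_toReal arr).mul_right c).add h1
  simp only [one_mul, sub_self, mul_zero, Finset.sum_const_zero, add_zero] at h2
  have e : (fun a => (arr a).toReal * (c + ∑ i, β i * ((a i : ℝ) - meanArrival arr i))) =
      fun a => (arr a).toReal * c + ∑ i, β i * ((arr a).toReal * (a i : ℝ) -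
        (arr a).toReal * meanArrival arr i) := by
    ext a
    rw [mul_add, Finset.mul_sum]
    congr 1
    exact Finset.sum_congr rfl fun i _ => by ring
  rw [e]
  exact h2

variable {net}

/-- The maximal weight. -/
def MaxWeightRule.value (rule : net.MaxWeightRule) (q : Queues N) (s : S) : ℝ :=
  net.weight q s (rule.choose q s)

variable (rule : net.MaxWeightRule)

/-- A maximum of functions with a common Lipschitz constant has that constant: each maximizer is
tested in the other state. -/
theorem MaxWeightRule.abs_value_sub_le : ∃ C : ℝ, 0 ≤ C ∧ ∀ (r : ℝ) (p q : Queues N) (s : S),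
    0 ≤ r → Near r p q → |rule.value p s - rule.value q s| ≤ C * r := by
  set C := ∑ _i : Fin N, ((∑ _j : Fin N, 2 * (net.rateMax : ℝ)) + net.rateMax +
        net.powerUnit * net.powerMax) with hC
  refine ⟨|C|, abs_nonneg _, fun r p q s hr h => ?_⟩
  refine le_trans ?_ (mul_le_mul_of_nonneg_right (le_abs_self C) hr)
  have e1 := abs_le.1 (net.abs_weight_sub_le h s (rule.choose p s))
  have e2 := abs_le.1 (net.abs_weight_sub_le h s (rule.choose q s))
  have e3 := rule.choose_max q s (rule.choose p s)
  have e4 := rule.choose_max p s (rule.choose q s)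
  rw [MaxWeightRule.value, MaxWeightRule.value, abs_le]
  constructor <;> linarith [e1.1, e1.2, e2.1, e2.2]

theorem MaxWeightRule.value_empty (s : S) : rule.value empty s = 0 := net.weight_empty _ _

/-- For arrival rates in the region, the mean of the maximal weight exceeds the weighted load. -/
theorem MaxWeightRule.load_le_value [Fintype S] [Fintype K] {π : PMF S} {ε : ℝ} {lam : Fin N → ℝ}
    (hlam : lam ∈ net.region π ε) (q : Queues N) :
    (∑ i, (q.X i : ℝ) * lam i) - (∑ i, net.powerUnit * q.U i * net.budget i) +
      ε * ∑ i, ((q.X i : ℝ) + q.Y i + net.powerUnit * q.U i) ≤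
    ∑ s, (π s).toReal * rule.value q s := by
  obtain ⟨w, θ, hw0, hw1, hθ, hX, hY, hU⟩ := hlam
  have hval : ∀ s, ∑ k, w s k * net.weight q s k ≤ rule.value q s := fun s =>
    calc _ ≤ ∑ k, w s k * rule.value q s :=
          Finset.sum_le_sum fun k _ => mul_le_mul_of_nonneg_left (rule.choose_max q s k) (hw0 s k)
      _ = rule.value q s := by rw [← Finset.sum_mul, hw1, one_mul]
  -- Serving the longer queue is at least as good as splitting the base link in proportions `θ` and
  -- `1 - θ`.
  have hweight : ∀ s k, ∑ i, ((q.X i : ℝ) *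
      (net.rate s k i none * θ i s k + ∑ j with j ≠ i, (net.rate s k i (some j) : ℝ)) +
      q.Y i * ((1 - θ i s k) * net.rate s k i none - ∑ j with j ≠ i, (net.rate s k j (some i) : ℝ)) -
      net.powerUnit * q.U i * net.usedPower k i) ≤ net.weight q s k := by
    intro s k
    have hswap : ∑ i, ∑ j with j ≠ i, (q.Y j : ℝ) * net.rate s k i (some j) =
        ∑ i, (q.Y i : ℝ) * ∑ j with j ≠ i, (net.rate s k j (some i) : ℝ) := by
      simp only [Finset.mul_sum, Finset.sum_filter]
      rw [Finset.sum_comm]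
      refine Finset.sum_congr rfl fun i _ => Finset.sum_congr rfl fun j _ => ?_
      by_cases h : i = j
      · simp [h]
      · simp [h, Ne.symm h]
    have hl : net.weight q s k = ∑ i, ((q.X i : ℝ) * (∑ j with j ≠ i, (net.rate s k i (some j) : ℝ)) +
        max (q.X i : ℝ) (q.Y i) * net.rate s k i none -
        net.powerUnit * q.U i * net.usedPower k i) -
        ∑ i, ∑ j with j ≠ i, (q.Y j : ℝ) * net.rate s k i (some j) := by
      rw [weight, ← Finset.sum_sub_distrib]
      refine Finset.sum_congr rfl fun i _ => ?_
      simp only [sub_mul, Finset.sum_sub_distrib, Finset.mul_sum]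
      ring
    rw [hl, hswap, ← Finset.sum_sub_distrib]
    refine Finset.sum_le_sum fun i _ => ?_
    have hmax : (q.X i : ℝ) * θ i s k + q.Y i * (1 - θ i s k) ≤ max (q.X i : ℝ) (q.Y i) := by
      have e1 := mul_le_mul_of_nonneg_right (le_max_left (q.X i : ℝ) (q.Y i)) (hθ i s k).1
      have e2 := mul_le_mul_of_nonneg_right (le_max_right (q.X i : ℝ) (q.Y i))
        (sub_nonneg.2 (hθ i s k).2)
      linarith
    have := mul_le_mul_of_nonneg_right hmax (Nat.cast_nonneg (α := ℝ) (net.rate s k i none))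
    linarith
  have hchain : ∑ s, ∑ k, (π s).toReal * w s k * ∑ i, ((q.X i : ℝ) *
      (net.rate s k i none * θ i s k + ∑ j with j ≠ i, (net.rate s k i (some j) : ℝ)) +
      q.Y i * ((1 - θ i s k) * net.rate s k i none - ∑ j with j ≠ i, (net.rate s k j (some i) : ℝ)) -
      net.powerUnit * q.U i * net.usedPower k i) ≤ ∑ s, (π s).toReal * rule.value q s := by
    refine Finset.sum_le_sum fun s _ => ?_
    refine le_trans ?_ (mul_le_mul_of_nonneg_left (hval s) ENNReal.toReal_nonneg)
    rw [Finset.mul_sum]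
    refine Finset.sum_le_sum fun k _ => ?_
    rw [mul_assoc]
    exact mul_le_mul_of_nonneg_left (mul_le_mul_of_nonneg_left (hweight s k) (hw0 s k))
      ENNReal.toReal_nonneg
  refine le_trans ?_ hchain
  -- Exchanging the sums isolates, for each station, the three averages that the region bounds.
  have hexch : ∑ s, ∑ k, (π s).toReal * w s k * ∑ i, ((q.X i : ℝ) *
      (net.rate s k i none * θ i s k + ∑ j with j ≠ i, (net.rate s k i (some j) : ℝ)) +
      q.Y i * ((1 - θ i s k) * net.rate s k i none - ∑ j with j ≠ i, (net.rate s k j (some i) : ℝ)) -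
      net.powerUnit * q.U i * net.usedPower k i) =
    ∑ i, ((q.X i : ℝ) * (∑ s, ∑ k, (π s).toReal * w s k *
      (net.rate s k i none * θ i s k + ∑ j with j ≠ i, (net.rate s k i (some j) : ℝ))) +
      q.Y i * ((∑ s, ∑ k, (π s).toReal * (1 - θ i s k) * w s k * net.rate s k i none) -
        ∑ s, ∑ k, ∑ j with j ≠ i, (π s).toReal * w s k * (net.rate s k j (some i) : ℝ)) -
      net.powerUnit * q.U i * ∑ s, ∑ k, (π s).toReal * w s k * net.usedPower k i) := by
    simp only [Finset.mul_sum (s := (Finset.univ : Finset (Fin N)))]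
    rw [Finset.sum_congr rfl fun s _ => Finset.sum_comm, Finset.sum_comm]
    refine Finset.sum_congr rfl fun i _ => ?_
    rw [← Finset.sum_sub_distrib]
    simp only [← Finset.sum_sub_distrib]
    rw [Finset.mul_sum, Finset.mul_sum, Finset.mul_sum, ← Finset.sum_add_distrib,
      ← Finset.sum_sub_distrib]
    refine Finset.sum_congr rfl fun s _ => ?_
    rw [Finset.mul_sum, Finset.mul_sum, Finset.mul_sum, ← Finset.sum_add_distrib,
      ← Finset.sum_sub_distrib]
    refine Finset.sum_congr rfl fun k _ => ?_
    rw [← Finset.mul_sum]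
    ring
  rw [hexch, ← Finset.sum_sub_distrib, Finset.mul_sum, ← Finset.sum_add_distrib]
  refine Finset.sum_le_sum fun i _ => ?_
  have e1 := mul_le_mul_of_nonneg_left (hX i) (Nat.cast_nonneg (α := ℝ) (q.X i))
  have e2 := mul_le_mul_of_nonneg_left (le_sub_iff_add_le'.2 (hY i))
    (Nat.cast_nonneg (α := ℝ) (q.Y i))
  have e3 := mul_le_mul_of_nonneg_left (le_sub_iff_add_le.2 (hU i))
    (mul_nonneg net.powerUnit_pos.le (Nat.cast_nonneg (α := ℝ) (q.U i)))
  nlinarith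

/-- A corrector of the maximal weight: a solution of the Poisson equation, Lipschitz in the
queues. -/
theorem MaxWeightRule.exists_corrector [Fintype S] {P : S → PMF S} {π : PMF S}
    (hP : IsIrreducible P) (hπ : IsStationary P π) :
    ∃ (h : Queues N → S → ℝ) (H : ℝ), 0 ≤ H ∧
      (∀ q s, ∑ s', (P s s').toReal * h q s' =
        h q s - rule.value q s + ∑ t, (π t).toReal * rule.value q t) ∧
      (∀ (r : ℝ) (p q : Queues N) (s : S), 0 ≤ r → Near r p q → |h p s - h q s| ≤ H * r) ∧
      ∀ q s, |h q s| ≤ H * q.total := by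
  classical
  obtain ⟨C, hC0, hC⟩ := rule.abs_value_sub_le
  choose G hG using fun t : S => exists_poisson hP hπ (Topology.sum_mul_indicator_sub π t)
  have hlip : ∀ (r : ℝ) (p q : Queues N) (s : S), 0 ≤ r → Near r p q →
      |∑ t, G t s * rule.value p t - ∑ t, G t s * rule.value q t| ≤
        (∑ s, ∑ t, |G t s| * C) * r := by
    intro r p q s hr hpq
    rw [← Finset.sum_sub_distrib]
    refine (Finset.abs_sum_le_sum_abs _ _).trans ?_
    refine le_trans ?_ (mul_le_mul_of_nonneg_right (Finset.single_le_sum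
      (f := fun s => ∑ t, |G t s| * C) (fun _ _ => Finset.sum_nonneg fun _ _ => by positivity)
      (Finset.mem_univ s)) hr)
    rw [Finset.sum_mul]
    refine Finset.sum_le_sum fun t _ => ?_
    rw [← mul_sub, abs_mul, mul_assoc]
    exact mul_le_mul_of_nonneg_left (hC r p q t hr hpq) (abs_nonneg _)
  -- The centred value is a combination of centred indicators with coefficients `rule.value q t`; by
  -- linearity so is the solution, which inherits the Lipschitz bound of the value.
  refine ⟨fun q s => ∑ t, G t s * rule.value q t, ∑ s, ∑ t, |G t s| * C,
    Finset.sum_nonneg fun _ _ => Finset.sum_nonneg fun _ _ => by positivity, ?_, hlip, ?_⟩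
  · intro q s
    have h1 : ∑ s', (P s s').toReal * ∑ t, G t s' * rule.value q t =
        ∑ t, (∑ s', (P s s').toReal * G t s') * rule.value q t := by
      simp only [Finset.mul_sum, Finset.sum_mul]
      rw [Finset.sum_comm]
      exact Finset.sum_congr rfl fun _ _ => Finset.sum_congr rfl fun _ _ => by ring
    have h2 : ∀ t, ∑ s', (P s s').toReal * G t s' =
        G t s - ((if s = t then (1 : ℝ) else 0) - (π t).toReal) := fun t => by
      linarith [hG t s]
    simp only [h1, h2, sub_mul, Finset.sum_sub_distrib, ite_mul, one_mul, zero_mul,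
      Finset.sum_ite_eq, Finset.mem_univ, if_true]
    ring
  · intro q s
    have := hlip q.total q empty s q.total_nonneg q.near_empty
    simpa [rule.value_empty] using this

end RelayNetwork

/-! ### Lyapunov drift over a frame, and stability. -/

namespace RelayNetwork

open MarkovChain Queues

variable {N : ℕ} {S K : Type*} {net : RelayNetwork N S K} (rule : net.MaxWeightRule)

/-- The energy dominates every multiple of the total up to a constant. -/
theorem exists_total_le_energy (H : ℝ) :
    ∃ c : ℝ, 0 ≤ c ∧ ∀ q : Queues N, 2 * (H * q.total) ≤ net.energy q + c := by
  have hpu := net.powerUnit_pos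
  refine ⟨∑ _i : Fin N, (2 * H ^ 2 + (H / net.powerUnit) ^ 2),
    Finset.sum_nonneg fun _ _ => by positivity, fun q => ?_⟩
  rw [energy, total, Finset.mul_sum, Finset.mul_sum, ← Finset.sum_add_distrib]
  refine Finset.sum_le_sum fun i _ => ?_
  have hU : 2 * (H * q.U i) ≤ (net.powerUnit * q.U i) ^ 2 + (H / net.powerUnit) ^ 2 := by
    have h1 : H * (q.U i : ℝ) = (net.powerUnit * q.U i) * (H / net.powerUnit) := by
      field_simp
    rw [h1]
    nlinarith [sq_nonneg (net.powerUnit * q.U i - H / net.powerUnit)]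
  nlinarith [sq_nonneg ((q.X i : ℝ) - H), sq_nonneg ((q.Y i : ℝ) - H)]

/-- The mean drift in a slot of the energy, corrected by a solution `h` of the Poisson equation
for the queues `q₀` that the decision is based on. -/
theorem expect_slot_le [Fintype S] [Fintype K] {P : S → PMF S} {π : PMF S} {ε κ : ℝ}
    {arr : PMF (Fin N → ℕ)} {Amax : ℕ} (harr : ∀ a ∈ arr.support, ∀ i, a i ≤ Amax)
    (hlam : meanArrival arr ∈ net.region π ε) (hκ0 : 0 ≤ κ)
    (hκ : ∀ q : Queues N, κ * q.total ≤ 2 * (ε * ∑ i, ((q.X i : ℝ) + q.Y i +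
      net.powerUnit * q.U i)))
    {h : Queues N → S → ℝ}
    (hh : ∀ q s, ∑ s', (P s s').toReal * h q s' =
        h q s - rule.value q s + ∑ t, (π t).toReal * rule.value q t)
    {R c : ℝ} {q q₀ : Queues N} (hq : Near R q q₀) (s : S)
    (hpos : ∀ a ∈ arr.support, ∀ s',
      0 ≤ net.energy (net.slot q s (rule.choose q₀ s) (rule.own q₀ s) a) - 2 * h q₀ s' + c) :
    expect arr (fun a => expect (P s) fun s' => ENNReal.ofReal
      (net.energy (net.slot q s (rule.choose q₀ s) (rule.own q₀ s) a) - 2 * h q₀ s' + c)) +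
      ENNReal.ofReal (κ * q₀.total) ≤
    ENNReal.ofReal (net.energy q - 2 * h q₀ s + c + ∑ _i : Fin N, (2 + net.powerUnit ^ 2) *
        (2 * ((net.stepBound Amax : ℝ) ^ 2 + R * net.stepBound Amax))) := by
  set C := ∑ _i : Fin N, (2 + net.powerUnit ^ 2) *
        (2 * ((net.stepBound Amax : ℝ) ^ 2 + R * net.stepBound Amax)) with hC
  set Φ := net.energy q - 2 * h q₀ s + c + C with hΦ
  have hD0 : 0 ≤ κ * q₀.total := mul_nonneg hκ0 q₀.total_nonneg
  -- The energy contributes `-2 * rule.value q₀ s`, the corrector `+2 * rule.value q₀ s` minus twice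
  -- the stationary mean, to which `load_le_value` applies. What remains of the arrivals is centred.
  have hmean : ∀ a ∈ arr.support, ∑ s', (P s s').toReal *
      (net.energy (net.slot q s (rule.choose q₀ s) (rule.own q₀ s) a) - 2 * h q₀ s' + c) +
        κ * q₀.total ≤ Φ + ∑ i, 2 * (q₀.X i : ℝ) * ((a i : ℝ) - meanArrival arr i) := by
    intro a ha
    have e1 := net.energy_slot_le hq s (rule.choose q₀ s) (rule.own_true q₀ s) (rule.own_false q₀ s)
      (harr a ha)
    have e2 := rule.load_le_value hlam q₀
    have e3 := hκ q₀
    have e4 : ∑ s', (P s s').toReal *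
        (net.energy (net.slot q s (rule.choose q₀ s) (rule.own q₀ s) a) - 2 * h q₀ s' + c) =
        (net.energy (net.slot q s (rule.choose q₀ s) (rule.own q₀ s) a) + c) *
          ∑ s', (P s s').toReal - 2 * ∑ s', (P s s').toReal * h q₀ s' := by
      rw [Finset.mul_sum, Finset.mul_sum, ← Finset.sum_sub_distrib]
      exact Finset.sum_congr rfl fun _ _ => by ring
    have e5 : ∑ i, 2 * (q₀.X i : ℝ) * ((a i : ℝ) - meanArrival arr i) =
        2 * ((∑ i, (q₀.X i : ℝ) * a i) - ∑ i, (q₀.X i : ℝ) * meanArrival arr i) := by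
      rw [← Finset.sum_sub_distrib, Finset.mul_sum]
      exact Finset.sum_congr rfl fun _ _ => by ring
    have e6 : net.weight q₀ s (rule.choose q₀ s) = rule.value q₀ s := rfl
    rw [e4, sum_toReal, hh, e5]
    rw [e6] at e1
    linarith
  have hnn : ∀ a ∈ arr.support, 0 ≤ ∑ s', (P s s').toReal *
      (net.energy (net.slot q s (rule.choose q₀ s) (rule.own q₀ s) a) - 2 * h q₀ s' + c) :=
    fun a ha => Finset.sum_nonneg fun s' _ => mul_nonneg ENNReal.toReal_nonneg (hpos a ha s')
  rw [← expect_const arr (ENNReal.ofReal (κ * q₀.total)), ← expect_add,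
    ← expect_arrivals harr Φ (fun i => 2 * (q₀.X i : ℝ))
      fun a ha => (add_nonneg (hnn a ha) hD0).trans (hmean a ha)]
  refine expect_mono_support fun a ha => ?_
  rw [expect_ofReal _ (hpos a ha), ← ENNReal.ofReal_add (hnn a ha) hD0]
  exact ENNReal.ofReal_le_ofReal (hmean a ha)

/-- A Lyapunov function for the chain of the frames. -/
theorem exists_lyapunov [Fintype S] [Fintype K] {P : S → PMF S} {π : PMF S}
    (hP : IsIrreducible P) (hπ : IsStationary P π) {ε κ : ℝ}
    {arr : PMF (Fin N → ℕ)} {Amax : ℕ} (harr : ∀ a ∈ arr.support, ∀ i, a i ≤ Amax)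
    (hlam : meanArrival arr ∈ net.region π ε) (hκ0 : 0 ≤ κ)
    (hκ : ∀ q : Queues N, κ * q.total ≤ 2 * (ε * ∑ i, ((q.X i : ℝ) + q.Y i +
      net.powerUnit * q.U i))) (T : ℕ) :
    ∃ (V : Queues N × S → ℝ) (b : ℝ), ∀ x,
      expect (frameChain rule P arr T x) (fun y => ENNReal.ofReal (V y)) +
        T * ENNReal.ofReal (κ * x.1.total) ≤ ENNReal.ofReal (V x) + ENNReal.ofReal b := by
  obtain ⟨h, H, hH0, hh, hlip, hlin⟩ := rule.exists_corrector hP hπ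
  obtain ⟨c, hc0, hc⟩ := exists_total_le_energy (net := net) H
  set B : ℝ := (net.stepBound Amax : ℝ) with hB
  have hB0 : 0 ≤ B := Nat.cast_nonneg _
  set R : ℝ := T * B with hR
  have hR0 : 0 ≤ R := by positivity
  set C := ∑ _i : Fin N, (2 + net.powerUnit ^ 2) * (2 * (B ^ 2 + R * B)) with hC
  have hC0 : 0 ≤ C := Finset.sum_nonneg fun _ _ => by positivity
  set V : Queues N × S → ℝ := fun x => net.energy x.1 - 2 * h x.1 x.2 + c with hV
  have hV0 : ∀ x, 0 ≤ V x := fun x => by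
    have e1 := hc x.1
    have e2 := (le_abs_self _).trans (hlin x.1 x.2)
    simp only [hV]
    linarith
  -- The corrector is frozen at `q₀` inside the frame; `2 * (H * R)` pays for passing to that of the
  -- final queues.
  set c₁ := c + 2 * (H * R) with hc₁
  have hVΦ : ∀ (q q₀ : Queues N) (s : S), Near R q q₀ →
      V (q, s) ≤ net.energy q - 2 * h q₀ s + c₁ := fun q q₀ s hq => by
    have e1 := (abs_le.1 (hlip R q q₀ s hR0 hq)).1
    simp only [hV, hc₁]
    linarith
  have hnear : ∀ m : ℕ, m ≤ T → (m : ℝ) * B ≤ R := fun m hm =>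
    mul_le_mul_of_nonneg_right (by exact_mod_cast hm) hB0
  -- Here `m` slots have elapsed and `n` remain. Each yields the same gain `κ * q₀.total`, since the
  -- decisions keep referring to `q₀`.
  have key : ∀ (q₀ : Queues N) (n m : ℕ) (x : Queues N × S), m + n ≤ T →
      Near ((m : ℝ) * B) x.1 q₀ →
      expect (runFrame rule P arr q₀ n x) (fun y => ENNReal.ofReal (V y)) +
        n * ENNReal.ofReal (κ * q₀.total) ≤
      ENNReal.ofReal (net.energy x.1 - 2 * h q₀ x.2 + c₁) + n * ENNReal.ofReal C := by
    intro q₀ n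
    induction n with
    | zero =>
      intro m x hm hx
      rw [runFrame, expect_pure]
      simp only [Nat.cast_zero, zero_mul, add_zero]
      exact ENNReal.ofReal_le_ofReal (hVΦ x.1 q₀ x.2 (hx.mono (hnear m hm)))
    | succ n ih =>
      intro m x hm hx
      have hx' : ∀ a ∈ arr.support, Near (((m + 1 : ℕ) : ℝ) * B)
          (net.slot x.1 x.2 (rule.choose q₀ x.2) (rule.own q₀ x.2) a) q₀ := by
        intro a ha
        have := (net.slot_near x.1 x.2 (rule.choose q₀ x.2) (rule.own q₀ x.2) (harr a ha)).trans hx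
        refine this.mono (le_of_eq ?_)
        push_cast
        ring
      rw [runFrame, expect_bind]
      simp only [expect_bind]
      have h1 := expect_slot_le rule harr hlam hκ0 hκ hh (c := c₁)
        (hx.mono (hnear m (by omega))) x.2
        fun a ha s' => (hV0 _).trans (hVΦ _ q₀ s' ((hx' a ha).mono (hnear (m + 1) (by omega))))
      have h2 : (expect arr fun a => expect (P x.2) fun s' => expect (runFrame rule P arr q₀ n
          (net.slot x.1 x.2 (rule.choose q₀ x.2) (rule.own q₀ x.2) a, s'))
            fun y => ENNReal.ofReal (V y)) + n * ENNReal.ofReal (κ * q₀.total) ≤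
          (expect arr fun a => expect (P x.2) fun s' => ENNReal.ofReal (net.energy
            (net.slot x.1 x.2 (rule.choose q₀ x.2) (rule.own q₀ x.2) a) - 2 * h q₀ s' + c₁)) +
            n * ENNReal.ofReal C := by
        conv_lhs => rw [← expect_const arr (n * ENNReal.ofReal (κ * q₀.total)), ← expect_add]
        conv_rhs => rw [← expect_const arr (n * ENNReal.ofReal C), ← expect_add]
        refine expect_mono_support fun a ha => ?_
        conv_lhs => rw [← expect_const (P x.2) (n * ENNReal.ofReal (κ * q₀.total)), ← expect_add]
        conv_rhs => rw [← expect_const (P x.2) (n * ENNReal.ofReal C), ← expect_add]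
        exact expect_mono fun s' => ih (m + 1) _ (by omega) (hx' a ha)
      have hnn : 0 ≤ net.energy x.1 - 2 * h q₀ x.2 + c₁ :=
        (hV0 _).trans (hVΦ _ q₀ x.2 (hx.mono (hnear m (by omega))))
      rw [ENNReal.ofReal_add hnn hC0] at h1
      push_cast
      rw [add_mul, add_mul, one_mul, one_mul, ← add_assoc, ← add_assoc]
      refine (add_le_add_left h2 _).trans ?_
      rw [add_right_comm]
      refine (add_le_add_left h1 _).trans (le_of_eq ?_)
      rw [add_right_comm]
  refine ⟨V, 2 * (H * R) + T * C, fun x => ?_⟩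
  have h0 := key x.1 T 0 x (by omega) (by simpa using Near.refl x.1)
  refine h0.trans (le_of_eq ?_)
  rw [ENNReal.ofReal_add (p := 2 * (H * R)) (by positivity) (by positivity),
    ENNReal.ofReal_mul (p := (T : ℝ)) (Nat.cast_nonneg _), ENNReal.ofReal_natCast,
    ← add_assoc (ENNReal.ofReal (V x)),
    ← ENNReal.ofReal_add (hV0 x) (by positivity)]
  simp only [hV, hc₁, add_assoc]

/-- Every positive slack gives stability, for frames of any length. -/
theorem isStable_of_mem_region [Fintype S] [Fintype K] {P : S → PMF S} {π : PMF S}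
    (hP : IsIrreducible P) (hπ : IsStationary P π) {ε : ℝ} (hε : 0 < ε)
    {arr : PMF (Fin N → ℕ)} {Amax : ℕ} (harr : ∀ a ∈ arr.support, ∀ i, a i ≤ Amax)
    (hlam : meanArrival arr ∈ net.region π ε) {T : ℕ} (hT : 1 ≤ T) :
    IsStable (frameChain rule P arr T) := by
  have hpu := net.powerUnit_pos
  -- `total` counts virtual queues in units, whereas the drift weighs them by `powerUnit`.
  set κ := 2 * (ε * min 1 net.powerUnit) with hκdef
  have hκ0 : 0 < κ := by positivity
  have hκ : ∀ q : Queues N, κ * q.total ≤ 2 * (ε * ∑ i, ((q.X i : ℝ) + q.Y i +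
      net.powerUnit * q.U i)) := by
    intro q
    rw [hκdef, mul_assoc, mul_assoc]
    refine mul_le_mul_of_nonneg_left (mul_le_mul_of_nonneg_left ?_ hε.le) zero_le_two
    rw [total, Finset.mul_sum]
    refine Finset.sum_le_sum fun i _ => ?_
    rw [mul_add, mul_add]
    refine add_le_add (add_le_add ?_ ?_) ?_
    · exact mul_le_of_le_one_left (Nat.cast_nonneg _) (min_le_left _ _)
    · exact mul_le_of_le_one_left (Nat.cast_nonneg _) (min_le_left _ _)
    · exact mul_le_mul_of_nonneg_right (min_le_right _ _) (Nat.cast_nonneg _)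
  obtain ⟨V, b, hV⟩ := exists_lyapunov rule hP hπ harr hlam hκ0.le hκ T
  have hle : ∀ x : Queues N × S, ENNReal.ofReal (κ * x.1.total) ≤
      T * ENNReal.ofReal (κ * x.1.total) := fun x =>
    le_mul_of_one_le_left zero_le (by exact_mod_cast hT)
  have : Nonempty S := ⟨π.support_nonempty.some⟩
  have : Nonempty (Queues N) := ⟨Queues.empty⟩
  have hfin : {x : Queues N × S | T * ENNReal.ofReal (κ * x.1.total) ≤
      ENNReal.ofReal b + 1}.Finite := by
    refine ((finite_total_le ((max b 0 + 1) / κ)).prod (Set.finite_univ (α := S))).subset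
      fun x hx => ⟨?_, Set.mem_univ _⟩
    have h1 := (hle x).trans hx
    have h2 : ENNReal.ofReal b + 1 = ENNReal.ofReal (max b 0 + 1) := by
      rw [ENNReal.ofReal_add (le_max_right _ _) zero_le_one, ENNReal.ofReal_one,
        ENNReal.ofReal_max, ENNReal.ofReal_zero, max_eq_left zero_le]
    rw [h2, ENNReal.ofReal_le_ofReal_iff (by positivity)] at h1
    rw [Set.mem_ofPred_eq, le_div_iff₀ hκ0]
    linarith
  obtain ⟨hrec, hex, hmean⟩ := foster (fun _ => ENNReal.ofReal_ne_top) ENNReal.ofReal_ne_top hV hfin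
  refine ⟨hrec, hex, fun ν hν i => ?_⟩
  have hq : ∀ g : Queues N × S → ℕ, (∀ x, (g x : ℝ) ≤ x.1.total) →
      expect ν (fun x => (g x : ℝ≥0∞)) < ∞ := by
    intro g hg
    refine (expect_mono (g := fun x => T * ENNReal.ofReal (κ * x.1.total) * ENNReal.ofReal κ⁻¹)
      fun x => ?_).trans_lt ?_
    · refine le_trans ?_ (mul_le_mul_left (hle x) _)
      rw [← ENNReal.ofReal_mul (mul_nonneg hκ0.le x.1.total_nonneg), mul_right_comm,
        mul_inv_cancel₀ hκ0.ne', one_mul, ← ENNReal.ofReal_natCast]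
      exact ENNReal.ofReal_le_ofReal (hg x)
    · rw [expect_mul_const]
      exact ENNReal.mul_lt_top ((hmean ν hν).trans_lt ENNReal.ofReal_lt_top) ENNReal.ofReal_lt_top
  have hbound : ∀ x : Queues N × S, (x.1.X i : ℝ) ≤ x.1.total ∧ (x.1.Y i : ℝ) ≤ x.1.total ∧
      (x.1.U i : ℝ) ≤ x.1.total := fun x => by
    have h0 := x.1.le_total i
    have h1 : (0 : ℝ) ≤ x.1.X i := Nat.cast_nonneg _
    have h2 : (0 : ℝ) ≤ x.1.Y i := Nat.cast_nonneg _
    have h3 : (0 : ℝ) ≤ x.1.U i := Nat.cast_nonneg _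
    exact ⟨by linarith, by linarith, by linarith⟩
  exact ⟨hq _ fun x => (hbound x).1, hq _ fun x => (hbound x).2.1, hq _ fun x => (hbound x).2.2⟩

end RelayNetwork

end

theorem theorem2 {N : ℕ} {S K : Type*} [Fintype S] [DecidableEq S] [Fintype K]
    (net : RelayNetwork N S K) (P : S → PMF S) (π : PMF S)
    (hP : MarkovChain.IsErgodic P) (hπ : MarkovChain.IsStationary P π) :
    -- every slack above the mismatch threshold of the frame length gives stability
    (∀ (T : ℕ), 1 ≤ T → ∀ (ρ : PMF S) (γ : PMF (List S × List S)),
      Topology.IsFrameCoupling P π T ρ γ →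
      ∀ ε : ℝ, (1 / 2 : ℝ) * max ((N + 1) * net.rateMax * Topology.meanMismatch T γ)
          (net.powerMax * Topology.meanMismatch T γ) < ε →
      ∀ lam ∈ net.region π ε, ∀ (arr : PMF (Fin N → ℕ)) (Amax : ℕ),
        (∀ a ∈ arr.support, ∀ i, a i ≤ Amax) → (∀ i, meanArrival arr i = lam i) →
      ∀ rule : net.MaxWeightRule,
        RelayNetwork.IsStable (RelayNetwork.frameChain rule P arr T)) ∧
    -- the expected mismatch per slot tends to zero
    (∀ η : ℝ, 0 < η → ∃ T₀ : ℕ, ∀ T ≥ T₀, ∀ (ρ : PMF S) (γ : PMF (List S × List S)),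
      Topology.IsFrameCoupling P π T ρ γ → Topology.meanMismatch T γ < η) ∧
    -- hence every positive slack is enough for all long frames
    (∀ ε : ℝ, 0 < ε → ∃ T₀ : ℕ, ∀ T ≥ T₀,
      ∀ lam ∈ net.region π ε, ∀ (arr : PMF (Fin N → ℕ)) (Amax : ℕ),
        (∀ a ∈ arr.support, ∀ i, a i ≤ Amax) → (∀ i, meanArrival arr i = lam i) →
      ∀ rule : net.MaxWeightRule,
        RelayNetwork.IsStable (RelayNetwork.frameChain rule P arr T)) := by
  have hstable : ∀ (T : ℕ), 1 ≤ T → ∀ ε : ℝ, 0 < ε →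
      ∀ lam ∈ net.region π ε, ∀ (arr : PMF (Fin N → ℕ)) (Amax : ℕ),
        (∀ a ∈ arr.support, ∀ i, a i ≤ Amax) → (∀ i, meanArrival arr i = lam i) →
      ∀ rule : net.MaxWeightRule,
        RelayNetwork.IsStable (RelayNetwork.frameChain rule P arr T) := by
    intro T hT ε hε lam hlam arr Amax harr hmean rule
    have hlam' : meanArrival arr ∈ net.region π ε := (funext hmean : meanArrival arr = lam) ▸ hlam
    exact RelayNetwork.isStable_of_mem_region rule hP.1 hπ hε harr hlam' hT
  -- The threshold is nonnegative through its first entry, so the slack is positive. In the last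
  -- part `T₀ = 1` suffices.
  refine ⟨fun T hT ρ γ _ ε hε => hstable T hT ε (lt_of_le_of_lt ?_ hε),
    fun η hη => Topology.exists_meanMismatch_lt hP.1 hπ hη,
    fun ε hε => ⟨1, fun T hT => hstable T hT ε hε⟩⟩
  have hmm : 0 ≤ Topology.meanMismatch T γ := div_nonneg ENNReal.toReal_nonneg (Nat.cast_nonneg _)
  exact mul_nonneg (by norm_num) (le_max_of_le_left (by positivity))
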